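/- Let $\kappa$ be an infinite regular cardinal, or the symbol $\infty$, which is deemed greater than every cardinal and ordinal. For a set $X$ let $\mathcal P_{<\kappa}X$ be the set of subsets of $X$ of size $<\kappa$; this is a functor via direct images. The ordinal $0$ counts as a limit ordinal, and a cardinal is identified with its initial ordinal. The final chain of $\mathcal P_{<\kappa}$ consists of sets $\nu_i$ ($i$ an ordinal) and connecting maps $\nu_{j,i}\colon\nu_i\to\nu_j$ ($j\le i$): $\nu_{i+1}=\mathcal P_{<\kappa}\nu_i$ and $\nu_{j+1,i+1}=\mathcal P_{<\kappa}(\nu_{j,i})$; for a limit $i$, $\nu_i$ is the set of all families $(a_j)_{j<i}$ with $a_j\in\nu_j$ and $\nu_{k,j}(a_j)=a_k$ for $k\le j<i$, and $\nu_{j,i}$ is the projection to the component $a_j$ for $j<i$ (so $\nu_0=\{()\}$). A $\mathcal P_{<\kappa}$-coalgebra $\zeta\colon X\to\mathcal P_{<\kappa}X$ has projections $p_i\colon X\to\nu_i$, with $p_{i+1}(x)=\{p_i(y)\mid y\in\zeta(x)\}$ and $p_i(x)=(p_j(x))_{j<i}$ for a limit $i$. An element of $\nu_i$ is *coalgebraic*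 if it equals $p_i(x)$ for some element $x$ of some $\mathcal P_{<\kappa}$-coalgebra. For a limit $i$, an element of $\nu_i$ is *Cauchy* if all its components are coalgebraic. A *pointed system* is a set with a binary relation $\rightsquigarrow$ and a chosen element; it is *$<\kappa$-branching* if every element reachable from the chosen one has fewer than $\kappa$ successors. Equivalence relations $\sim_i$ between pointed systems are defined by: $x\sim_{i+1}x'$ iff every successor $y$ of $x$ has a successor $y'$ of $x'$ with $y\sim_i y'$, and vice versa; for a limit $i$, $x\sim_i x'$ iff $x\sim_j x'$ for all $j<i$. A sequence $(x_j)_{j<i}$ of pointed systems is *Cauchy* if $x_j\sim_j x_k$ for all $j\le k<i$; a *limit* of it is a pointed system $y$ with $x_j\sim_j y$ for all $j<i$. An ordinal is *$\omega$-cofinal* if it is the supremum of a strictly increasing sequence $(i_n)_{n\in\mathbb N}$. A regular infinite cardinal $\lambda$ is *weakly compact* if $|A|<\lambda$ implies $|\mathcal P A|<\lambda$ and every tidy $\lambda$-tree all of whose levels have size $<\lambda$ has a full branch (so $\aleph_0$ is weakly compact). Here a *tidy $\lambda$-tree* is a family of sets $(D_i)_{i<\lambda}$ with a functorial system of surjections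 $D_i\to D_j$ ($j\le i$), with $D_0\neq\emptyset$, such that for each limit $i<\lambda$ the elements of $D_i$ are determined by their images in the $D_j$, $j<i$; a *full branch* is a compatible family $(x_i)_{i<\lambda}$, $x_i\in D_i$. For a limit ordinal $i$ let $(\ast)$ be the condition: $i\neq\kappa$, and $i$ is $0$, or $\omega$-cofinal, or weakly compact, or $\kappa<\infty$ and $i\ge\kappa+\omega$. **(1)** For every limit ordinal $i$: every Cauchy element of $\nu_i$ is coalgebraic if and only if $i$ satisfies $(\ast)$. **(2)** For every ordinal $i$: every Cauchy sequence $(x_j)_{j<i}$ of $<\kappa$-branching pointed systems has a $<\kappa$-branching limit if and only if $i$ is a successor or $i$ is a limit satisfying $(\ast)$. -/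

import Mathlib

open Cardinal

universe u v

namespace Ghost

/-! ### Sizes

`κ` is a cardinal or the symbol `∞` that exceeds every cardinal: an element of
`WithTop Cardinal`. "Sets" are types in `Type u` (or elements of `ZFSet.{u}`), and ordinals and
cardinals are those of the same universe. -/

/-- `κ` is `∞`, or an infinite regular cardinal. -/
def IsInfiniteRegular (κ : WithTop Cardinal.{u}) : Prop :=
  ∀ c : Cardinal.{u}, κ = (c : WithTop Cardinal.{u}) → c.IsRegular

/-! ### Pointed systems and the approximants to bisimilarity -/

/-- A transition system: a set with a binary relation; `step x y` says that `y` is a successor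
of `x`. -/
structure TransitionSystem where
  carrier : Type u
  step : carrier → carrier → Prop

/-- A pointed system: a transition system with a chosen element. -/
structure PointedSystem extends TransitionSystem.{u} where
  point : carrier

/-- `(M, x)` is `<κ`-branching: everything reachable from `x` has `<κ`-many successors. -/
def PointedSystem.IsBranching (κ : WithTop Cardinal.{u}) (x : PointedSystem.{u}) : Prop :=
  ∀ y : x.carrier, Relation.ReflTransGen x.step x.point y →
    ((#{z // x.step y z} : Cardinal.{u}) : WithTop Cardinal.{u}) < κ

/-- The relation `∼ᵢ` between the elements of two transition systems, by recursion on `i`. At a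
limit (`0` counts as a limit) it is the intersection of the earlier relations. -/
noncomputable def simElem (M N : TransitionSystem.{u}) (i : Ordinal.{u}) :
    M.carrier → N.carrier → Prop :=
  SuccOrder.prelimitRecOn (motive := fun _ => M.carrier → N.carrier → Prop) i
    (fun _ _ R x x' =>
      (∀ y, M.step x y → ∃ y', N.step x' y' ∧ R y y') ∧
      (∀ y', N.step x' y' → ∃ y, M.step x y ∧ R y y'))
    (fun i _ R x x' => ∀ (j : Ordinal.{u}) (hj : j < i), R j hj x x')

/-- The relation `x ∼ᵢ y` between pointed systems. -/
def PointedSystem.Sim (i : Ordinal.{u}) (x y : PointedSystem.{u}) : Prop :=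
  simElem x.toTransitionSystem y.toTransitionSystem i x.point y.point

/-- An `i`-sequence `(x_j)_{j<i}` of pointed systems is Cauchy when `x_j ∼_j x_k` for all
`j ≤ k < i`. -/
def IsCauchySeq {i : Ordinal.{u}} (x : Set.Iio i → PointedSystem.{u}) : Prop :=
  ∀ j k : Set.Iio i, j ≤ k → PointedSystem.Sim j.1 (x j) (x k)

/-- `y` is a limit of `(x_j)_{j<i}` when `x_j ∼_j y` for all `j < i`. -/
def IsLimitOfSeq {i : Ordinal.{u}} (x : Set.Iio i → PointedSystem.{u})
    (y : PointedSystem.{u}) : Prop :=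
  ∀ j : Set.Iio i, PointedSystem.Sim j.1 (x j) y

/-! ### The final chain of `P_{<κ}`

The levels are sets of sets. Tuples `(x_j)_{j<i}` are, as usual in set theory, the functions with
domain the von Neumann ordinal `i`, so that `()` is the empty set. -/

/-- The tuple `(x_j)_{j<i}`, i.e. the set of all ordered pairs `(j, x_j)`. -/
noncomputable def tuple (i : Ordinal.{u}) (x : Set.Iio i → ZFSet.{u}) : ZFSet.{u} :=
  ZFSet.range (fun j : Set.Iio i => ZFSet.pair (Ordinal.toZFSet j.1) (x j))

open Classical in
/-- The `j`-th component of a tuple `a` (the empty set when there is none). -/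
noncomputable def component (j : Ordinal.{u}) (a : ZFSet.{u}) : ZFSet.{u} :=
  if h : ∃ b, ZFSet.pair (Ordinal.toZFSet j) b ∈ a then h.choose else ∅

open Classical in
/-- `connFrom i j`, meaningful for `j ≤ i`, is the connecting map from level `i` to level `j`.
* If `i = k + 1` and `j = l + 1`, it is `P_{<κ}` of the connecting map from `k` to `l`, that is,
  `a ↦ {conn b | b ∈ a}`; this formula is the same for all `κ`.
* If `i` is a successor and `j` is a limit, it is the map into the limit, with components the
  connecting maps from `i` to the `l < j`.
* If `i` is a limit and `j < i`, it is the projection to the `j`-th component; from `i` to `i` it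
  is the identity. -/
noncomputable def connFrom (i : Ordinal.{u}) : Ordinal.{u} → ZFSet.{u} → ZFSet.{u} :=
  SuccOrder.prelimitRecOn (motive := fun _ => Ordinal.{u} → ZFSet.{u} → ZFSet.{u}) i
    (fun _ _ connk j =>
      SuccOrder.prelimitRecOn (motive := fun _ => ZFSet.{u} → ZFSet.{u}) j
        (fun l _ _ a => ZFSet.range (fun b : {b // b ∈ a} => connk l b.1))
        (fun j _ conni a => tuple j (fun l => conni l.1 l.2 a)))
    (fun i _ _ j a => if j < i then component j a else a)

/-- The connecting map from level `i` to level `j` of the final chain, for `j ≤ i`. -/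
noncomputable def conn (j i : Ordinal.{u}) (a : ZFSet.{u}) : ZFSet.{u} := connFrom i j a

/-- The level `ν_i P_{<κ}` of the final chain: level `k + 1` consists of the `<κ`-sized subsets of
level `k`; the level at a limit `i` (`0` included) consists of the full branches through the
earlier levels. -/
noncomputable def finalChain (κ : WithTop Cardinal.{u}) (i : Ordinal.{u}) : Set ZFSet.{u} :=
  SuccOrder.prelimitRecOn (motive := fun _ => Set ZFSet.{u}) i
    (fun _ _ L => {a | (∀ b ∈ a, b ∈ L) ∧ ((ZFSet.card a : Cardinal.{u}) : WithTop Cardinal.{u}) < κ})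
    (fun i _ L => {a | ∃ x : Set.Iio i → ZFSet.{u},
      (∀ j : Set.Iio i, x j ∈ L j.1 j.2) ∧
      (∀ k j : Set.Iio i, k ≤ j → conn k.1 j.1 (x j) = x k) ∧
      a = tuple i x})

/-! ### Coalgebras, coalgebraic elements and Cauchy elements -/

/-- The set of `<κ`-sized subsets of `X`. -/
def PsetLT (κ : WithTop Cardinal.{u}) (X : Type u) : Type u :=
  {s : Set X // ((#s : Cardinal.{u}) : WithTop Cardinal.{u}) < κ}

/-- A `P_{<κ}`-coalgebra. -/
structure PsetCoalgebra (κ : WithTop Cardinal.{u}) where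
  carrier : Type u
  str : carrier → PsetLT κ carrier

/-- The `i`-th coalgebra projection, from a coalgebra to the `i`-th level of the final chain. -/
noncomputable def PsetCoalgebra.proj {κ : WithTop Cardinal.{u}} (M : PsetCoalgebra.{u} κ)
    (i : Ordinal.{u}) : M.carrier → ZFSet.{u} :=
  SuccOrder.prelimitRecOn (motive := fun _ => M.carrier → ZFSet.{u}) i
    (fun _ _ p x => ZFSet.range (fun y : {y // y ∈ (M.str x).1} => p y.1))
    (fun i _ p x => tuple i (fun j => p j.1 j.2 x))

/-- An element of `ν_i P_{<κ}` is `P_{<κ}`-coalgebraic when it is the `i`-th projection of a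
pointed `P_{<κ}`-coalgebra. -/
def IsCoalgebraic (κ : WithTop Cardinal.{u}) (i : Ordinal.{u}) (a : ZFSet.{u}) : Prop :=
  ∃ (M : PsetCoalgebra.{u} κ) (x : M.carrier), M.proj i x = a

/-- For a limit `i`, an element of `ν_i P_{<κ}` is `P_{<κ}`-Cauchy when all its components are
`P_{<κ}`-coalgebraic. -/
def IsCauchy (κ : WithTop Cardinal.{u}) (i : Ordinal.{u}) (a : ZFSet.{u}) : Prop :=
  a ∈ finalChain κ i ∧ ∀ j < i, IsCoalgebraic κ j (component j a)

/-! ### Trees and the classification of ordinals -/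

/-- An inverse `I`-chain of sets. -/
structure InverseChain (I : Type v) [Preorder I] where
  level : I → Type u
  map : ∀ {j i : I}, j ≤ i → level i → level j
  map_refl : ∀ (i : I) (x : level i), map (le_refl i) x = x
  map_map : ∀ {k j i : I} (hkj : k ≤ j) (hji : j ≤ i) (x : level i),
    map hkj (map hji x) = map (hkj.trans hji) x

/-- A full branch: an element of each level, compatible with the connecting maps. -/
def InverseChain.IsFullBranch {I : Type v} [Preorder I] (D : InverseChain.{u, v} I)
    (x : ∀ i, D.level i) : Prop :=
  ∀ (j i : I) (h : j ≤ i), D.map h (x i) = x j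

/-- A tidy tree: connecting maps are surjective; for each limit `i` (the least index included), a
full branch through the levels below `i` extends in at most one way to level `i`; there is a
root, i.e. an element of the level at the least index. -/
structure InverseChain.IsTidy {I : Type v} [LinearOrder I] (D : InverseChain.{u, v} I) :
    Prop where
  surj : ∀ (j i : I) (h : j ≤ i), Function.Surjective (D.map h)
  limit : ∀ i : I, Order.IsSuccPrelimit i → ∀ x y : D.level i,
    (∀ (j : I) (h : j < i), D.map h.le x = D.map h.le y) → x = y
  root : ∃ i : I, IsBot i ∧ Nonempty (D.level i)

/-- The tree property: every tidy `c`-tree with all levels `<c`-sized has a full branch. -/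
def TreeProperty (c : Cardinal.{u}) : Prop :=
  ∀ D : InverseChain.{u, u + 1} (Set.Iio c.ord), D.IsTidy → (∀ i, #(D.level i) < c) →
    ∃ x, D.IsFullBranch x

/-- Strong inaccessibility of a regular infinite cardinal; `ℵ₀` is allowed. -/
def StronglyInaccessible (c : Cardinal.{u}) : Prop :=
  ∀ A : Type u, #A < c → #(Set A) < c

/-- The ordinal `i` is (the initial ordinal of) a weakly compact cardinal: a regular infinite
cardinal that is strongly inaccessible and has the tree property. In particular `ω` is. -/
def IsWeaklyCompact (i : Ordinal.{u}) : Prop :=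
  ∃ c : Cardinal.{u}, i = c.ord ∧ c.IsRegular ∧ StronglyInaccessible c ∧ TreeProperty c

/-- `i` is the supremum of a strictly increasing sequence `(i_n)_{n ∈ ℕ}`. -/
def IsOmegaCofinal (i : Ordinal.{u}) : Prop :=
  ∃ f : ℕ → Ordinal.{u}, StrictMono f ∧ IsLUB (Set.range f) i

/-- `i ≥ κ + ω`, for `κ < ∞` (false for `κ = ∞`). -/
def GeAddOmega (κ : WithTop Cardinal.{u}) (i : Ordinal.{u}) : Prop :=
  ∃ c : Cardinal.{u}, κ = (c : WithTop Cardinal.{u}) ∧ c.ord + Ordinal.omega0 ≤ i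

/-- `i = κ`, for `κ < ∞` (false for `κ = ∞`). -/
def EqKappa (κ : WithTop Cardinal.{u}) (i : Ordinal.{u}) : Prop :=
  ∃ c : Cardinal.{u}, κ = (c : WithTop Cardinal.{u}) ∧ i = c.ord

/-- The limits `i` of the classification: `i ≠ κ`, and `i` is `0` or `ω`-cofinal or weakly compact
or `≥ κ + ω`. -/
def IsGoodLimit (κ : WithTop Cardinal.{u}) (i : Ordinal.{u}) : Prop :=
  ¬ EqKappa κ i ∧ (i = 0 ∨ IsOmegaCofinal i ∨ IsWeaklyCompact i ∨ GeAddOmega κ i)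

end Ghost

namespace Ghost

/-! ### Approximants to bisimilarity -/

/-! Two points have the same projection to `ν_i` exactly when they are `∼ᵢ`-equivalent. So for a
limit `i`, Cauchy elements correspond to Cauchy `i`-sequences and being coalgebraic to having a
`<κ`-branching limit; both claims reduce to `SeqComplete`.

Completeness. Beyond `κ`, the term of index `κ` is a limit, because `∼_κ` is bisimilarity on
`<κ`-branching systems. If `|i| < κ`, a limit is built whose states are themselves Cauchy sequences
(`CauchyIn.exists_limit`), provided that each successor of a term belongs, up to equivalence, to a
Cauchy sequence of successors (`HasExtensions`). For `ω`-cofinal `i` such a sequence is built step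
by step; for weakly compact `i` it is a branch of a tree with small levels.

Incompleteness. At `κ`, the sequence of ordinals `j < κ` forces `κ` successors on any limit. At the
other bad limits `|i| < κ`, and an inverse system of sets of systems without a branch suffices
(`not_seqComplete_of_family`). If `cof i ≤ 2^|β|` for some `β < i`, finite subsets of a cofinal set
are coded: a branch would yield a cofinal set with finite initial segments, making `i` `ω`-cofinal.
If there is no such `β`, then `i` is regular and strongly inaccessible, so the tree property fails,
and a tree without a full branch is coded by sets of ordinals. -/

theorem simElem_succ (M N : TransitionSystem.{u}) (i : Ordinal.{u}) (x : M.carrier)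
    (x' : N.carrier) : simElem M N (Order.succ i) x x' ↔
      (∀ y, M.step x y → ∃ y', N.step x' y' ∧ simElem M N i y y') ∧
      (∀ y', N.step x' y' → ∃ y, M.step x y ∧ simElem M N i y y') := by
  unfold simElem
  rw [SuccOrder.prelimitRecOn_succ]

theorem simElem_limit (M N : TransitionSystem.{u}) {i : Ordinal.{u}} (hi : Order.IsSuccPrelimit i)
    (x : M.carrier) (x' : N.carrier) :
    simElem M N i x x' ↔ ∀ j < i, simElem M N j x x' := by
  unfold simElem
  rw [SuccOrder.prelimitRecOn_of_isSuccPrelimit _ _ hi]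

/-- A uniform description of `∼ᵢ`, without a case distinction on `i`. -/
theorem simElem_iff (M N : TransitionSystem.{u}) (i : Ordinal.{u}) (x : M.carrier)
    (x' : N.carrier) : simElem M N i x x' ↔ ∀ j < i,
      (∀ y, M.step x y → ∃ y', N.step x' y' ∧ simElem M N j y y') ∧
      (∀ y', N.step x' y' → ∃ y, M.step x y ∧ simElem M N j y y') := by
  induction i using WellFoundedLT.induction generalizing x x' with
  | ind i ih =>
  by_cases hi : Order.IsSuccPrelimit i
  · rw [simElem_limit _ _ hi]
    constructor
    · intro h j hj
      exact (simElem_succ ..).1 (h _ (hi.succ_lt hj))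
    · intro h j hj
      exact (ih j hj _ _).2 fun k hk => h k (hk.trans hj)
  · obtain ⟨k, -, rfl⟩ := Order.not_isSuccPrelimit_iff_succ_eq.1 hi
    have mono : ∀ j ≤ k, ∀ (y : M.carrier) (y' : N.carrier),
        simElem M N k y y' → simElem M N j y y' := by
      intro j hj y y' h
      have hjk := Order.lt_succ_of_le hj
      rw [ih j hjk]
      exact fun l hl => (ih k (Order.lt_succ k) _ _).1 h l (hl.trans_le hj)
    rw [simElem_succ]
    constructor
    · rintro ⟨h₁, h₂⟩ j hj
      have hj := Order.le_of_lt_succ hj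
      exact ⟨fun y hy => (h₁ y hy).imp fun y' h => ⟨h.1, mono j hj _ _ h.2⟩,
        fun y hy => (h₂ y hy).imp fun y' h => ⟨h.1, mono j hj _ _ h.2⟩⟩
    · exact fun h => h k (Order.lt_succ k)

theorem simElem_mono {M N : TransitionSystem.{u}} {i j : Ordinal.{u}} (hj : j ≤ i)
    {x : M.carrier} {x' : N.carrier} (h : simElem M N i x x') : simElem M N j x x' := by
  rw [simElem_iff] at h ⊢
  exact fun k hk => h k (hk.trans_le hj)

theorem simElem_of_bisim {M N : TransitionSystem.{u}} (R : M.carrier → N.carrier → Prop)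
    (h₁ : ∀ x x', R x x' → ∀ y, M.step x y → ∃ y', N.step x' y' ∧ R y y')
    (h₂ : ∀ x x', R x x' → ∀ y', N.step x' y' → ∃ y, M.step x y ∧ R y y')
    (i : Ordinal.{u}) {x : M.carrier} {x' : N.carrier} (h : R x x') : simElem M N i x x' := by
  induction i using WellFoundedLT.induction generalizing x x' with
  | ind i ih =>
  rw [simElem_iff]
  exact fun j hj => ⟨fun y hy => (h₁ _ _ h y hy).imp fun y' h => ⟨h.1, ih j hj h.2⟩,
    fun y hy => (h₂ _ _ h y hy).imp fun y' h => ⟨h.1, ih j hj h.2⟩⟩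

theorem simElem_refl (M : TransitionSystem.{u}) (i : Ordinal.{u}) (x : M.carrier) :
    simElem M M i x x :=
  simElem_of_bisim (fun x x' => x = x') (by rintro x _ rfl y h; exact ⟨y, h, rfl⟩)
    (by rintro x _ rfl y h; exact ⟨y, h, rfl⟩) i rfl

theorem simElem_symm {M N : TransitionSystem.{u}} {i : Ordinal.{u}} {x : M.carrier}
    {x' : N.carrier} (h : simElem M N i x x') : simElem N M i x' x := by
  induction i using WellFoundedLT.induction generalizing x x' with
  | ind i ih =>
  rw [simElem_iff] at h ⊢
  exact fun j hj => ⟨fun y hy => ((h j hj).2 y hy).imp fun _ h => ⟨h.1, ih j hj h.2⟩,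
    fun y hy => ((h j hj).1 y hy).imp fun _ h => ⟨h.1, ih j hj h.2⟩⟩

theorem simElem_trans {M N P : TransitionSystem.{u}} {i : Ordinal.{u}} {x : M.carrier}
    {y : N.carrier} {z : P.carrier} (h : simElem M N i x y) (h' : simElem N P i y z) :
    simElem M P i x z := by
  induction i using WellFoundedLT.induction generalizing x y z with
  | ind i ih =>
  rw [simElem_iff] at h h' ⊢
  intro j hj
  constructor
  · intro x' hx
    obtain ⟨y', hy, h₁⟩ := (h j hj).1 x' hx
    obtain ⟨z', hz, h₂⟩ := (h' j hj).1 y' hy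
    exact ⟨z', hz, ih j hj h₁ h₂⟩
  · intro z' hz
    obtain ⟨y', hy, h₁⟩ := (h' j hj).2 z' hz
    obtain ⟨x', hx, h₂⟩ := (h j hj).2 y' hy
    exact ⟨x', hx, ih j hj h₂ h₁⟩

/-- Matching of a successor, in the form used for elements of one system. -/
theorem exists_step_of_simElem {M N : TransitionSystem.{u}} {i j : Ordinal.{u}} (hj : j < i)
    {x : M.carrier} {x' : N.carrier} (h : simElem M N i x x') {y : M.carrier}
    (hy : M.step x y) : ∃ y', N.step x' y' ∧ simElem M N j y y' :=
  ((simElem_iff ..).1 h j hj).1 y hy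

namespace PointedSystem

theorem Sim.mono {i j : Ordinal.{u}} (hj : j ≤ i) {x y : PointedSystem.{u}} (h : Sim i x y) :
    Sim j x y := simElem_mono hj h

theorem Sim.refl (i : Ordinal.{u}) (x : PointedSystem.{u}) : Sim i x x := simElem_refl ..

theorem Sim.symm {i : Ordinal.{u}} {x y : PointedSystem.{u}} (h : Sim i x y) : Sim i y x :=
  simElem_symm h

theorem Sim.trans {i : Ordinal.{u}} {x y z : PointedSystem.{u}} (h : Sim i x y)
    (h' : Sim i y z) : Sim i x z := simElem_trans h h'

/-- The same system with another chosen element. -/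
def pt (x : PointedSystem.{u}) (y : x.carrier) : PointedSystem.{u} :=
  ⟨x.toTransitionSystem, y⟩

end PointedSystem

/-! ### Types of size less than `κ` -/

/-- The type `α`, of any universe, has size `<κ`. -/
def SizeLT (κ : WithTop Cardinal.{u}) (α : Type v) : Prop :=
  ∃ (β : Type u) (f : β → α), Function.Surjective f ∧ ((#β : Cardinal.{u}) : WithTop Cardinal.{u}) < κ

section SizeLT

universe w
variable {κ : WithTop Cardinal.{u}}

theorem SizeLT.of_surjective {α : Type v} {β : Type w} (h : SizeLT κ α) (f : α → β)
    (hf : Function.Surjective f) : SizeLT κ β := by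
  obtain ⟨γ, g, hg, hγ⟩ := h
  exact ⟨γ, f ∘ g, hf.comp hg, hγ⟩

theorem sizeLT_iff {α : Type u} :
    SizeLT κ α ↔ ((#α : Cardinal.{u}) : WithTop Cardinal.{u}) < κ := by
  constructor
  · rintro ⟨β, f, hf, hβ⟩
    exact (WithTop.coe_le_coe.2 (mk_le_of_surjective hf)).trans_lt hβ
  · exact fun h => ⟨α, id, Function.surjective_id, h⟩

theorem SizeLT.of_injective {α : Type v} {β : Type w} (h : SizeLT κ β) (f : α → β)
    (hf : Function.Injective f) : SizeLT κ α := by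
  obtain ⟨γ, g, hg, hγ⟩ := h
  -- Restricting to the part of `γ` that meets the image of `f` avoids a default value in `α`.
  refine ⟨{c : γ // ∃ a, f a = g c}, fun c => c.2.choose, ?_, ?_⟩
  · intro a
    obtain ⟨c, hc⟩ := hg (f a)
    exact ⟨⟨c, a, hc.symm⟩, hf ((⟨c, a, hc.symm⟩ : {c : γ // ∃ a, f a = g c}).2.choose_spec.trans hc)⟩
  · exact (WithTop.coe_le_coe.2 (mk_subtype_le _)).trans_lt hγ

theorem SizeLT.subtype {α : Type v} (h : SizeLT κ α) (p : α → Prop) : SizeLT κ {a // p a} :=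
  h.of_injective _ Subtype.val_injective

theorem IsInfiniteRegular.aleph0_le (hκ : IsInfiniteRegular κ) : ((ℵ₀ : Cardinal.{u}) : WithTop Cardinal.{u}) ≤ κ := by
  induction κ using WithTop.recTopCoe with
  | top => exact le_top
  | coe c => exact WithTop.coe_le_coe.2 (hκ c rfl).aleph0_le

theorem sizeLT_of_finite (hκ : IsInfiniteRegular κ) {α : Type v} [Finite α] : SizeLT κ α := by
  obtain ⟨n, ⟨e⟩⟩ := Finite.exists_equiv_fin α
  refine SizeLT.of_surjective (α := ULift.{u} (Fin n)) ?_ (e.symm ∘ ULift.down)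
    (e.symm.surjective.comp ULift.down_surjective)
  rw [sizeLT_iff]
  exact lt_of_lt_of_le (WithTop.coe_lt_coe.2 (lt_aleph0_of_finite _)) hκ.aleph0_le

theorem SizeLT.sigma (hκ : IsInfiniteRegular κ) {α : Type v} {β : α → Type w} (h : SizeLT κ α)
    (hβ : ∀ a, SizeLT κ (β a)) : SizeLT κ (Σ a, β a) := by
  obtain ⟨γ, g, hg, hγ⟩ := h
  choose δ f hf hδ using hβ
  refine SizeLT.of_surjective (α := Σ c : γ, δ (g c)) ?_ (fun p => ⟨g p.1, f _ p.2⟩) ?_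
  · rw [sizeLT_iff]
    induction κ using WithTop.recTopCoe with
    | top => exact WithTop.coe_lt_top _
    | coe c =>
      rw [WithTop.coe_lt_coe] at hγ ⊢
      rw [mk_sigma]
      exact sum_lt_of_isRegular (hκ c rfl) hγ fun a => WithTop.coe_lt_coe.1 (hδ _)
  · rintro ⟨a, b⟩
    obtain ⟨c, rfl⟩ := hg a
    obtain ⟨d, rfl⟩ := hf _ b
    exact ⟨⟨c, d⟩, rfl⟩

theorem SizeLT.option (hκ : IsInfiniteRegular κ) {α : Type v} (h : SizeLT κ α) :
    SizeLT κ (Option α) := by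
  rcases isEmpty_or_nonempty α with h' | h'
  · exact sizeLT_of_finite hκ
  refine ((sizeLT_of_finite hκ (α := Bool)).sigma hκ (β := fun _ => α) fun _ => h).of_surjective
    (fun p => if p.1 then some p.2 else none) ?_
  rintro (_ | a)
  · exact ⟨⟨false, Classical.arbitrary α⟩, rfl⟩
  · exact ⟨⟨true, a⟩, rfl⟩

theorem sizeLT_Iio {o : Ordinal.{u}} :
    SizeLT κ (Set.Iio o) ↔ ((o.card : Cardinal.{u}) : WithTop Cardinal.{u}) < κ := by
  rw [← Cardinal.mk_toType, ← sizeLT_iff]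
  exact ⟨fun h => h.of_injective _ (Ordinal.ToType.mk (o := o)).symm.injective,
    fun h => h.of_surjective _ (Ordinal.ToType.mk (o := o)).symm.surjective⟩

end SizeLT

namespace PointedSystem

/-! ### Systems with prescribed successors -/

theorem isBranching_iff {κ : WithTop Cardinal.{u}} {x : PointedSystem.{u}} :
    x.IsBranching κ ↔ ∀ y, Relation.ReflTransGen x.step x.point y → SizeLT κ {z // x.step y z} := by
  simp only [sizeLT_iff]
  rfl

section collect

variable {ι : Type v} [Small.{u} ι]

/-- The successor relation of `collect x`. -/
inductive CollectStep (x : ι → PointedSystem.{u}) :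
    Option (Σ a : Shrink.{u} ι, (x ((equivShrink ι).symm a)).carrier) →
    Option (Σ a : Shrink.{u} ι, (x ((equivShrink ι).symm a)).carrier) → Prop
  | root (a : Shrink.{u} ι) : CollectStep x none (some ⟨a, (x _).point⟩)
  | inner (a : Shrink.{u} ι) (y z : (x ((equivShrink ι).symm a)).carrier) (h : (x _).step y z) :
    CollectStep x (some ⟨a, y⟩) (some ⟨a, z⟩)

/-- A new element whose successors are the systems `x a`. -/
def collect (x : ι → PointedSystem.{u}) : PointedSystem.{u} :=
  ⟨⟨Option (Σ a : Shrink.{u} ι, (x ((equivShrink ι).symm a)).carrier), CollectStep x⟩, none⟩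

variable {x : ι → PointedSystem.{u}}

theorem simElem_collect (a : Shrink.{u} ι) (y : (x ((equivShrink ι).symm a)).carrier)
    (i : Ordinal.{u}) :
    simElem (collect x).toTransitionSystem (x ((equivShrink ι).symm a)).toTransitionSystem i
      (some ⟨a, y⟩) y := by
  refine simElem_of_bisim (fun u v => u = some ⟨a, v⟩) ?_ ?_ i rfl
  · rintro _ v rfl w h
    cases h with
    | inner _ _ z h => exact ⟨z, h, rfl⟩
  · rintro _ v rfl w h
    exact ⟨some ⟨a, w⟩, .inner _ _ _ h, rfl⟩

theorem collect_step (a : ι) : ∃ z, (collect x).step (collect x).point z ∧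
    ∀ i, Sim i ((collect x).pt z) (x a) := by
  obtain ⟨a, rfl⟩ := (equivShrink ι).symm.surjective a
  exact ⟨some ⟨a, _⟩, .root a, fun i => simElem_collect a _ i⟩

theorem of_collect_step {z : (collect x).carrier} (h : (collect x).step (collect x).point z) :
    ∃ a, ∀ i, Sim i ((collect x).pt z) (x a) := by
  cases h with
  | root a => exact ⟨_, fun i => simElem_collect a _ i⟩

theorem Sim.exists_step_of_collect {i j : Ordinal.{u}} {y : PointedSystem.{u}}
    (h : Sim i (collect x) y) (hj : j < i) (a : ι) :
    ∃ z, y.step y.point z ∧ Sim j (x a) (y.pt z) := by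
  obtain ⟨z, hz, hz'⟩ := collect_step (x := x) a
  obtain ⟨w, hw, hw'⟩ := exists_step_of_simElem hj h hz
  exact ⟨w, hw, (hz' j).symm.trans hw'⟩

theorem Sim.exists_of_collect {i j : Ordinal.{u}} {y : PointedSystem.{u}}
    (h : Sim i (collect x) y) (hj : j < i) {z : y.carrier} (hz : y.step y.point z) :
    ∃ a, Sim j (x a) (y.pt z) := by
  obtain ⟨w, hw, hw'⟩ := exists_step_of_simElem hj h.symm hz
  obtain ⟨a, ha⟩ := of_collect_step hw
  exact ⟨a, (ha j).symm.trans (simElem_symm hw')⟩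

theorem sim_collect_iff {ι' : Type*} [Small.{u} ι'] {x' : ι' → PointedSystem.{u}}
    {i : Ordinal.{u}} : Sim i (collect x) (collect x') ↔
      ∀ j < i, (∀ a, ∃ b, Sim j (x a) (x' b)) ∧ ∀ b, ∃ a, Sim j (x a) (x' b) := by
  constructor
  · intro h j hj
    constructor
    · intro a
      obtain ⟨z, hz, hz'⟩ := h.exists_step_of_collect hj a
      exact (of_collect_step hz).imp fun b hb => hz'.trans (hb j)
    · intro b
      obtain ⟨z, hz, hz'⟩ := h.symm.exists_step_of_collect hj b
      exact (of_collect_step hz).imp fun a ha => (hz'.trans (ha j)).symm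
  · intro h
    refine (simElem_iff ..).2 fun j hj => ⟨fun z hz => ?_, fun z hz => ?_⟩
    · obtain ⟨a, ha⟩ := of_collect_step hz
      obtain ⟨b, hb⟩ := (h j hj).1 a
      obtain ⟨w, hw, hw'⟩ := collect_step (x := x') b
      exact ⟨w, hw, ((ha j).trans hb).trans (hw' j).symm⟩
    · obtain ⟨b, hb⟩ := of_collect_step hz
      obtain ⟨a, ha⟩ := (h j hj).2 b
      obtain ⟨w, hw, hw'⟩ := collect_step (x := x) a
      exact ⟨w, hw, ((hw' j).trans ha).trans (hb j).symm⟩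

theorem sim_collect_of_forall {x' : ι → PointedSystem.{u}} {i : Ordinal.{u}}
    (h : ∀ a, Sim i (x a) (x' a)) : Sim i (collect x) (collect x') :=
  sim_collect_iff.2 fun _ hj => ⟨fun a => ⟨a, (h a).mono hj.le⟩, fun a => ⟨a, (h a).mono hj.le⟩⟩

theorem isBranching_collect {κ : WithTop Cardinal.{u}} (hι : SizeLT κ ι)
    (hx : ∀ a, (x a).IsBranching κ) : (collect x).IsBranching κ := by
  -- The root is never re-entered, so a path into the copy of `x a` is a path in `x a` from its
  -- chosen element.
  have key : ∀ z : (collect x).carrier, Relation.ReflTransGen (collect x).step none z →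
      ∀ a y, z = some ⟨a, y⟩ → Relation.ReflTransGen (x _).step (x _).point y := by
    intro z hz
    induction hz with
    | refl => intro a y h; cases h
    | tail _ h ih =>
      intro a y e
      cases h with
      | root b => cases e; exact .refl
      | inner b z w h => cases e; exact (ih _ _ rfl).tail h
  rw [isBranching_iff]
  rintro (_ | ⟨a, y⟩) hz
  · refine hι.of_surjective (fun a => ⟨some ⟨equivShrink ι a, (x _).point⟩, .root _⟩) ?_
    rintro ⟨_, ⟨a⟩⟩
    obtain ⟨a, rfl⟩ := (equivShrink ι).surjective a
    exact ⟨a, rfl⟩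
  · refine (isBranching_iff.1 (hx _) y (key _ hz _ _ rfl)).of_surjective
      (fun z => ⟨some ⟨a, z.1⟩, .inner _ _ _ z.2⟩) ?_
    rintro ⟨_, ⟨⟩⟩
    exact ⟨⟨_, ‹_›⟩, rfl⟩

end collect

/-! ### Ordinals as systems -/

/-- The ordinal `o`, with its elements as successors. -/
noncomputable def ordSys (o : Ordinal.{u}) : PointedSystem.{u} :=
  collect fun a : Set.Iio o => ordSys a.1
termination_by o
decreasing_by exact a.2

/-- A successor `c ≥ j` is matched with `j` itself, since by induction `∼_j` does not separate
ordinals `≥ j`; a successor `c < j` belongs to both sides. -/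
theorem sim_ordSys_of_le {i a b : Ordinal.{u}} (ha : i ≤ a) (hb : i ≤ b) :
    Sim i (ordSys a) (ordSys b) := by
  induction i using WellFoundedLT.induction generalizing a b with
  | ind i ih =>
  rw [ordSys, ordSys, sim_collect_iff]
  intro j hj
  constructor
  · rintro ⟨c, hc⟩
    rcases le_total j c with h | h
    · exact ⟨⟨j, hj.trans_le hb⟩, ih j hj h le_rfl⟩
    · exact ⟨⟨c, (h.trans_lt hj).trans_le hb⟩, .refl _ _⟩
  · rintro ⟨c, hc⟩
    rcases le_total j c with h | h
    · exact ⟨⟨j, hj.trans_le ha⟩, ih j hj le_rfl h⟩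
    · exact ⟨⟨c, (h.trans_lt hj).trans_le ha⟩, .refl _ _⟩

theorem eq_of_sim_ordSys {i a b : Ordinal.{u}} (h : Sim i (ordSys a) (ordSys b)) (ha : a < i) :
    a = b := by
  induction a using WellFoundedLT.induction generalizing i b with
  | ind a ih =>
  rw [ordSys, ordSys, sim_collect_iff] at h
  obtain ⟨h₁, h₂⟩ := h a ha
  apply le_antisymm
  · by_contra! hb
    obtain ⟨⟨c, hc⟩, h⟩ := h₁ ⟨b, hb⟩
    exact hc.ne' (ih b hb h hb)
  · by_contra! hb
    obtain ⟨⟨c, hc⟩, h⟩ := h₂ ⟨a, hb⟩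
    exact hc.ne (ih c hc h hc)

theorem sim_ordSys_iff {i a b : Ordinal.{u}} :
    Sim i (ordSys a) (ordSys b) ↔ a = b ∨ i ≤ a ∧ i ≤ b := by
  constructor
  · intro h
    by_contra! hab
    rcases lt_or_ge a i with ha | ha
    · exact hab.1 (eq_of_sim_ordSys h ha)
    · exact hab.1 (eq_of_sim_ordSys h.symm (hab.2 ha)).symm
  · rintro (rfl | ⟨ha, hb⟩)
    · exact .refl _ _
    · exact sim_ordSys_of_le ha hb

theorem isBranching_ordSys {κ : WithTop Cardinal.{u}} {o : Ordinal.{u}}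
    (ho : SizeLT κ (Set.Iio o)) : (ordSys o).IsBranching κ := by
  induction o using WellFoundedLT.induction with
  | ind o ih =>
  rw [ordSys]
  refine isBranching_collect ho fun a => ih _ a.2 (ho.of_injective (fun b : Set.Iio a.1 =>
    (⟨b.1, lt_trans (Set.mem_Iio.1 b.2) a.2⟩ : Set.Iio o)) ?_)
  intro b c h
  simpa [Subtype.ext_iff] using h

end PointedSystem

/-! ### Coalgebras as transition systems -/

section Coalgebra

variable {κ : WithTop Cardinal.{u}}

/-- The transition system of a coalgebra. -/
abbrev PsetCoalgebra.toSystem (M : PsetCoalgebra.{u} κ) : TransitionSystem.{u} :=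
  ⟨M.carrier, fun x y => y ∈ (M.str x).1⟩

/-- A coalgebra with a chosen element, as a pointed system. -/
def PsetCoalgebra.toPointed (M : PsetCoalgebra.{u} κ) (x : M.carrier) : PointedSystem.{u} :=
  ⟨M.toSystem, x⟩

theorem PsetCoalgebra.isBranching (M : PsetCoalgebra.{u} κ) (x : M.carrier) :
    (M.toPointed x).IsBranching κ := fun y _ => (M.str y).2

/-- The coalgebra of the elements reachable in a `<κ`-branching pointed system. -/
def PointedSystem.reach (x : PointedSystem.{u}) (hx : x.IsBranching κ) : PsetCoalgebra.{u} κ where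
  carrier := {y : x.carrier // Relation.ReflTransGen x.step x.point y}
  str y := ⟨{z | x.step y.1 z.1}, sizeLT_iff.1 <|
    (sizeLT_iff.2 (hx y.1 y.2)).of_injective (fun z => ⟨z.1.1, z.2⟩) fun a b h => by
      simpa [Subtype.ext_iff] using h⟩

theorem PointedSystem.simElem_reach (x : PointedSystem.{u}) (hx : x.IsBranching κ)
    (y : (x.reach hx).carrier) (i : Ordinal.{u}) :
    simElem (x.reach hx).toSystem x.toTransitionSystem i y y.1 := by
  refine simElem_of_bisim (M := (x.reach hx).toSystem) (fun u v => u.1 = v) ?_ ?_ i rfl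
  · rintro u _ rfl w h
    exact ⟨w.1, h, rfl⟩
  · rintro u _ rfl w h
    exact ⟨⟨w, u.2.tail h⟩, h, rfl⟩

/-- The chosen element, in the coalgebra of reachable elements. -/
def PointedSystem.root (x : PointedSystem.{u}) (hx : x.IsBranching κ) : (x.reach hx).carrier :=
  ⟨x.point, .refl⟩

theorem PointedSystem.sim_root (x : PointedSystem.{u}) (hx : x.IsBranching κ) (i : Ordinal.{u}) :
    Sim i ((x.reach hx).toPointed (x.root hx)) x := x.simElem_reach hx _ i

end Coalgebra

/-! ### The final chain -/

section FinalChain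

variable {κ : WithTop Cardinal.{u}}

theorem proj_succ (M : PsetCoalgebra.{u} κ) (i : Ordinal.{u}) (x : M.carrier) :
    M.proj (Order.succ i) x = ZFSet.range (fun y : {y // y ∈ (M.str x).1} => M.proj i y.1) := by
  unfold PsetCoalgebra.proj
  rw [SuccOrder.prelimitRecOn_succ]

theorem proj_limit (M : PsetCoalgebra.{u} κ) {i : Ordinal.{u}} (hi : Order.IsSuccPrelimit i)
    (x : M.carrier) : M.proj i x = tuple i (fun j => M.proj j.1 x) := by
  unfold PsetCoalgebra.proj
  rw [SuccOrder.prelimitRecOn_of_isSuccPrelimit _ _ hi]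

theorem conn_succ_succ (j i : Ordinal.{u}) (a : ZFSet.{u}) :
    conn (Order.succ j) (Order.succ i) a = ZFSet.range (fun b : {b // b ∈ a} => conn j i b.1) := by
  unfold conn connFrom
  rw [SuccOrder.prelimitRecOn_succ, SuccOrder.prelimitRecOn_succ]

theorem conn_limit_succ {j : Ordinal.{u}} (hj : Order.IsSuccPrelimit j) (i : Ordinal.{u})
    (a : ZFSet.{u}) :
    conn j (Order.succ i) a = tuple j (fun l => conn l.1 (Order.succ i) a) := by
  unfold conn connFrom
  rw [SuccOrder.prelimitRecOn_succ, SuccOrder.prelimitRecOn_of_isSuccPrelimit _ _ hj]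

theorem conn_limit {i : Ordinal.{u}} (hi : Order.IsSuccPrelimit i) (j : Ordinal.{u})
    (a : ZFSet.{u}) : conn j i a = if j < i then component j a else a := by
  unfold conn connFrom
  rw [SuccOrder.prelimitRecOn_of_isSuccPrelimit _ _ hi]

theorem finalChain_succ (i : Ordinal.{u}) : finalChain κ (Order.succ i) =
    {a | (∀ b ∈ a, b ∈ finalChain κ i) ∧
      ((ZFSet.card a : Cardinal.{u}) : WithTop Cardinal.{u}) < κ} := by
  unfold finalChain
  rw [SuccOrder.prelimitRecOn_succ]

theorem finalChain_limit {i : Ordinal.{u}} (hi : Order.IsSuccPrelimit i) : finalChain κ i =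
    {a | ∃ x : Set.Iio i → ZFSet.{u}, (∀ j : Set.Iio i, x j ∈ finalChain κ j.1) ∧
      (∀ k j : Set.Iio i, k ≤ j → conn k.1 j.1 (x j) = x k) ∧ a = tuple i x} := by
  unfold finalChain
  rw [SuccOrder.prelimitRecOn_of_isSuccPrelimit _ _ hi]

theorem component_tuple {i : Ordinal.{u}} (x : Set.Iio i → ZFSet.{u}) (j : Set.Iio i) :
    component j.1 (tuple i x) = x j := by
  have h : ∃ b, ZFSet.pair (Ordinal.toZFSet j.1) b ∈ tuple i x := 
    ⟨x j, ZFSet.mem_range.2 ⟨j, rfl⟩⟩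
  rw [component, dif_pos h]
  obtain ⟨k, hk⟩ := ZFSet.mem_range.1 h.choose_spec
  obtain ⟨h₁, h₂⟩ := ZFSet.pair_inj.1 hk
  rw [← h₂, Subtype.ext (Ordinal.toZFSet_injective h₁)]

/-- The inner induction on `j` is needed because the map from a successor level to a limit level is
given by the maps from that same level to the lower ones. -/
theorem conn_proj (M : PsetCoalgebra.{u} κ) {j i : Ordinal.{u}} (hj : j ≤ i) (x : M.carrier) :
    conn j i (M.proj i x) = M.proj j x := by
  induction i using WellFoundedLT.induction generalizing j x with
  | ind i ih =>
  by_cases hi : Order.IsSuccPrelimit i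
  · rw [conn_limit hi]
    split_ifs with h
    · rw [proj_limit M hi]
      exact component_tuple (fun j => M.proj j.1 x) ⟨j, h⟩
    · rw [le_antisymm hj (not_lt.1 h)]
  · obtain ⟨k, -, rfl⟩ := Order.not_isSuccPrelimit_iff_succ_eq.1 hi
    induction j using WellFoundedLT.induction with
    | ind j ihj =>
    by_cases h : Order.IsSuccPrelimit j
    · rw [conn_limit_succ h, proj_limit M h]
      congr 1
      funext l
      exact ihj l.1 l.2 (le_trans (le_of_lt l.2) hj)
    · obtain ⟨l, -, rfl⟩ := Order.not_isSuccPrelimit_iff_succ_eq.1 h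
      rw [conn_succ_succ, proj_succ, proj_succ]
      have ih := fun y => ih k (Order.lt_succ k) (Order.succ_le_succ_iff.1 hj) y
      ext z
      simp only [ZFSet.mem_range, Subtype.exists, exists_prop]
      constructor
      · rintro ⟨_, ⟨y, hy, rfl⟩, rfl⟩
        exact ⟨y, hy, (ih y).symm⟩
      · rintro ⟨y, hy, rfl⟩
        exact ⟨_, ⟨y, hy, rfl⟩, ih y⟩

theorem proj_mem_finalChain (M : PsetCoalgebra.{u} κ) (i : Ordinal.{u}) (x : M.carrier) :
    M.proj i x ∈ finalChain κ i := by
  induction i using WellFoundedLT.induction generalizing x with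
  | ind i ih =>
  by_cases hi : Order.IsSuccPrelimit i
  · rw [finalChain_limit hi, proj_limit M hi]
    exact ⟨_, fun j => ih j.1 j.2 x, fun k j h => conn_proj M h x, rfl⟩
  · obtain ⟨k, -, rfl⟩ := Order.not_isSuccPrelimit_iff_succ_eq.1 hi
    rw [finalChain_succ, proj_succ]
    refine ⟨?_, ?_⟩
    · intro b hb
      obtain ⟨y, rfl⟩ := ZFSet.mem_range.1 hb
      exact ih k (Order.lt_succ k) y.1
    · refine lt_of_le_of_lt (WithTop.coe_le_coe.2 ?_) (M.str x).2
      have := ZFSet.lift_card_range_le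
        (f := fun y : {y // y ∈ (M.str x).1} => M.proj k y.1)
      simpa using this

/-- Both sides satisfy the same recursion: at successors, extensionality of sets is the
back-and-forth condition. -/
theorem proj_eq_proj_iff (M N : PsetCoalgebra.{u} κ) (i : Ordinal.{u}) (x : M.carrier)
    (y : N.carrier) : M.proj i x = N.proj i y ↔ simElem M.toSystem N.toSystem i x y := by
  induction i using WellFoundedLT.induction generalizing x y with
  | ind i ih =>
  by_cases hi : Order.IsSuccPrelimit i
  · rw [simElem_limit _ _ hi, proj_limit M hi, proj_limit N hi]
    constructor
    · intro h j hj
      have := congrArg (component j) h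
      rw [component_tuple (fun j => M.proj j.1 x) ⟨j, hj⟩,
        component_tuple (fun j => N.proj j.1 y) ⟨j, hj⟩] at this
      exact (ih j hj _ _).1 this
    · intro h
      congr 1
      funext j
      exact (ih j.1 j.2 _ _).2 (h j.1 j.2)
  · obtain ⟨k, -, rfl⟩ := Order.not_isSuccPrelimit_iff_succ_eq.1 hi
    have ih := ih k (Order.lt_succ k)
    rw [simElem_succ, proj_succ, proj_succ, ZFSet.ext_iff]
    simp only [ZFSet.mem_range, Subtype.exists, exists_prop]
    constructor
    · intro h
      constructor
      · intro x' hx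
        obtain ⟨y', hy, e⟩ := (h _).1 ⟨x', hx, rfl⟩
        exact ⟨y', hy, (ih _ _).1 e.symm⟩
      · intro y' hy
        obtain ⟨x', hx, e⟩ := (h _).2 ⟨y', hy, rfl⟩
        exact ⟨x', hx, (ih _ _).1 e⟩
    · rintro ⟨h₁, h₂⟩ z
      constructor
      · rintro ⟨x', hx, rfl⟩
        obtain ⟨y', hy, e⟩ := h₁ x' hx
        exact ⟨y', hy, ((ih _ _).2 e).symm⟩
      · rintro ⟨y', hy, rfl⟩
        obtain ⟨x', hx, e⟩ := h₂ y' hy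
        exact ⟨x', hx, (ih _ _).2 e⟩

/-- Every Cauchy `i`-sequence of `<κ`-branching pointed systems has a `<κ`-branching limit. -/
def SeqComplete (κ : WithTop Cardinal.{u}) (i : Ordinal.{u}) : Prop :=
  ∀ x : Set.Iio i → PointedSystem.{u}, (∀ j, (x j).IsBranching κ) → IsCauchySeq x →
    ∃ y : PointedSystem.{u}, y.IsBranching κ ∧ IsLimitOfSeq x y

theorem forall_isCauchy_isCoalgebraic_iff {i : Ordinal.{u}} (hi : Order.IsSuccPrelimit i) :
    (∀ a ∈ finalChain κ i, IsCauchy κ i a → IsCoalgebraic κ i a) ↔ SeqComplete κ i := by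
  constructor
  · intro H x hx hc
    -- Only the reachable part of `x j` is known to be a coalgebra, so the components are projected
    -- from there.
    let p : Set.Iio i → ZFSet.{u} := fun j => ((x j).reach (hx j)).proj j.1 ((x j).root (hx j))
    have hp : ∀ k j : Set.Iio i, k ≤ j → conn k.1 j.1 (p j) = p k := by
      intro k j hkj
      dsimp only [p]
      rw [conn_proj _ (show k.1 ≤ j.1 from hkj), eq_comm, proj_eq_proj_iff]
      exact (((x k).sim_root (hx k) k.1).trans (hc k j hkj)).trans
        ((x j).sim_root (hx j) k.1).symm
    have hmem : tuple i p ∈ finalChain κ i := by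
      rw [finalChain_limit hi]
      exact ⟨p, fun j => proj_mem_finalChain _ _ _, hp, rfl⟩
    obtain ⟨M, y, hy⟩ := H _ hmem ⟨hmem, fun j hj =>
      ⟨_, (x ⟨j, hj⟩).root (hx _), (component_tuple p ⟨j, hj⟩).symm⟩⟩
    refine ⟨M.toPointed y, M.isBranching y, fun j => ?_⟩
    have h := congrArg (component j.1) hy
    rw [component_tuple, proj_limit M hi, component_tuple (fun j => M.proj j.1 y) j,
      proj_eq_proj_iff] at h
    exact ((x j).sim_root (hx j) j.1).symm.trans (PointedSystem.Sim.symm (x := M.toPointed y) h)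
  · rintro H _ ha ⟨-, hc⟩
    rw [finalChain_limit hi] at ha
    obtain ⟨p, -, hp, rfl⟩ := ha
    have hc' : ∀ j : Set.Iio i, IsCoalgebraic κ j.1 (p j) := fun j =>
      component_tuple p j ▸ hc j.1 j.2
    choose M x hx using hc'
    have hC : IsCauchySeq fun j => (M j).toPointed (x j) := by
      intro k j hkj
      refine (proj_eq_proj_iff (M k) (M j) k.1 (x k) (x j)).1 ?_
      rw [hx k, ← hp k j hkj, ← hx j, conn_proj _ (show k.1 ≤ j.1 from hkj)]
    obtain ⟨y, hy, hl⟩ := H _ (fun j => (M j).isBranching _) hC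
    refine ⟨y.reach hy, y.root hy, ?_⟩
    rw [proj_limit _ hi]
    congr 1
    funext j
    rw [← hx j, proj_eq_proj_iff]
    exact (y.sim_root hy j.1).trans (hl j).symm

theorem seqComplete_succ (i : Ordinal.{u}) : SeqComplete κ (Order.succ i) := by
  intro x hx hc
  exact ⟨x ⟨i, Order.lt_succ i⟩, hx _, fun j =>
    hc _ _ (show j.1 ≤ i from Order.le_of_lt_succ j.2)⟩

end FinalChain

/-! ### Lengths beyond `κ` -/

/-- Otherwise each of the fewer than `c` candidates fails at some stage below `c`. By regularity the
supremum of these stages is below `c`, and a match at that stage is a contradiction. -/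
theorem exists_step_of_simElem_ord {c : Cardinal.{u}} (hc : c.IsRegular) {M N : TransitionSystem.{u}}
    {x y : M.carrier} {x' : N.carrier} (hN : #{z // N.step x' z} < c)
    (h : simElem M N c.ord x x') (hy : M.step x y) :
    ∃ y', N.step x' y' ∧ simElem M N c.ord y y' := by
  have hlim : Order.IsSuccPrelimit c.ord := (isSuccLimit_ord hc.aleph0_le).isSuccPrelimit
  by_contra! hcon
  have hcon' : ∀ y' : {z // N.step x' z}, ∃ j < c.ord, ¬ simElem M N j y y'.1 := by
    intro y'
    have := hcon y'.1 y'.2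
    rw [simElem_limit _ _ hlim] at this
    push Not at this
    exact this
  choose j hj hj' using hcon'
  have hs : (⨆ a, j a) < c.ord := Ordinal.iSup_lt_of_lt_cof (hc.cof_ord.symm ▸ hN) hj
  obtain ⟨y', hy', h'⟩ := exists_step_of_simElem hs h hy
  exact hj' ⟨y', hy'⟩ (simElem_mono (Ordinal.le_iSup j _) h')

/-- On `<c`-branching systems, for `c` regular, `∼_c` is bisimilarity. -/
theorem PointedSystem.Sim.of_ord {c : Cardinal.{u}} (hc : c.IsRegular) {x y : PointedSystem.{u}}
    (hx : x.IsBranching c) (hy : y.IsBranching c) (h : Sim c.ord x y) (i : Ordinal.{u}) :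
    Sim i x y := by
  refine simElem_of_bisim (fun u v => Relation.ReflTransGen x.step x.point u ∧
    Relation.ReflTransGen y.step y.point v ∧
    simElem x.toTransitionSystem y.toTransitionSystem c.ord u v) ?_ ?_ i ⟨.refl, .refl, h⟩
  · rintro u v ⟨hu, hv, h⟩ w hw
    obtain ⟨w', hw', h'⟩ := exists_step_of_simElem_ord hc (WithTop.coe_lt_coe.1 (hy v hv)) h hw
    exact ⟨w', hw', hu.tail hw, hv.tail hw', h'⟩
  · rintro u v ⟨hu, hv, h⟩ w hw
    obtain ⟨w', hw', h'⟩ := exists_step_of_simElem_ord hc (WithTop.coe_lt_coe.1 (hx u hu))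
      (simElem_symm h) hw
    exact ⟨w', hw', hu.tail hw', hv.tail hw, simElem_symm h'⟩

theorem seqComplete_of_ord_lt {c : Cardinal.{u}} (hc : c.IsRegular) {i : Ordinal.{u}}
    (hi : c.ord < i) : SeqComplete (c : WithTop Cardinal.{u}) i := by
  intro x hx hC
  refine ⟨x ⟨c.ord, hi⟩, hx _, fun j => ?_⟩
  rcases le_total j.1 c.ord with h | h
  · exact hC _ _ h
  · exact ((hC ⟨c.ord, hi⟩ j h).of_ord hc (hx _) (hx _) _).symm

/-! ### The system of Cauchy sequences -/

/-- A Cauchy sequence of elements of one system. -/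
def CauchyIn (M : TransitionSystem.{u}) {i : Ordinal.{u}} (z : Set.Iio i → M.carrier) : Prop :=
  ∀ k l : Set.Iio i, k ≤ l → simElem M M k.1 (z k) (z l)

/-- The successor, below a limit. -/
def next {i : Ordinal.{u}} (hi : Order.IsSuccPrelimit i) (k : Set.Iio i) : Set.Iio i :=
  ⟨Order.succ k.1, hi.succ_lt k.2⟩

/-- `w` is a Cauchy sequence of successors of the members of `z`, up to a shift. -/
structure IsSuccSeq (M : TransitionSystem.{u}) {i : Ordinal.{u}} (hi : Order.IsSuccPrelimit i)
    (z w : Set.Iio i → M.carrier) : Prop where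
  cauchy : CauchyIn M w
  step : ∀ k, M.step (z (next hi k)) (w k)

/-- Every successor in a Cauchy sequence is a member, up to `∼_j`, of a Cauchy sequence of
successors. -/
def HasExtensions (M : TransitionSystem.{u}) {i : Ordinal.{u}} (hi : Order.IsSuccPrelimit i) :
    Prop :=
  ∀ z : Set.Iio i → M.carrier, CauchyIn M z → ∀ (j : Set.Iio i) (v : M.carrier),
    M.step (z (next hi j)) v → ∃ w, IsSuccSeq M hi z w ∧ simElem M M j.1 (w j) v

/-- The states are the Cauchy sequences, and the successors of `z` are the chosen extensions `G z j
v` only. They are indexed by pairs `(j, v)`, so regularity of `κ` keeps their number below `κ`. By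
induction on `j`, the state `z` is `∼_j`-equivalent to its `j`-th term. -/
theorem CauchyIn.exists_limit {κ : WithTop Cardinal.{u}} (hκ : IsInfiniteRegular κ)
    {i : Ordinal.{u}} (hi : Order.IsSuccPrelimit i) (hiκ : SizeLT κ (Set.Iio i))
    (M : PsetCoalgebra.{u} κ) (hM : HasExtensions M.toSystem hi) {z : Set.Iio i → M.carrier}
    (hz : CauchyIn M.toSystem z) :
    ∃ y : PointedSystem.{u}, y.IsBranching κ ∧ ∀ j, PointedSystem.Sim j.1 (M.toPointed (z j)) y := by
  choose! G hG hGv using hM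
  let C := {z : Set.Iio i → M.carrier // CauchyIn M.toSystem z}
  -- `r` decodes a state into the sequence it stands for.
  let r : Shrink.{u} C → Set.Iio i → M.carrier := fun z => ((equivShrink C).symm z).1
  have hr : ∀ z, CauchyIn M.toSystem (r z) := fun z => ((equivShrink C).symm z).2
  have hr' : ∀ z (hz : CauchyIn M.toSystem z), r (equivShrink C ⟨z, hz⟩) = z := fun z hz => by
    simp [r]
  let N : TransitionSystem.{u} := ⟨Shrink.{u} C, fun z w =>
    ∃ j v, M.toSystem.step (r z (next hi j)) v ∧ r w = G (r z) j v⟩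
  have key : ∀ j : Set.Iio i, ∀ z : Shrink.{u} C, simElem N M.toSystem j.1 z (r z j) := by
    rintro ⟨j, hj⟩
    induction j using WellFoundedLT.induction with
    | ind j ih =>
    intro z
    rw [simElem_iff]
    intro l hlj
    have hl : l < i := hlj.trans hj
    -- To match successors up to `∼_l` one passes from `z_j` to `z_{l+1}`, whose successors are
    -- those recorded at index `l`.
    have hle : next hi ⟨l, hl⟩ ≤ ⟨j, hj⟩ := Order.succ_le_of_lt hlj
    have hs := hr z _ _ hle
    constructor
    · rintro w ⟨k, v, hv, hw⟩
      have hS := hG _ (hr z) k v hv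
      rw [← hw] at hS
      obtain ⟨u, hu, hu'⟩ := exists_step_of_simElem (Order.lt_succ l) hs (hS.step ⟨l, hl⟩)
      exact ⟨u, hu, simElem_trans (ih l hlj hl w) hu'⟩
    · intro u hu
      obtain ⟨v, hv, hv'⟩ := exists_step_of_simElem (Order.lt_succ l) (simElem_symm hs) hu
      have hS := hG _ (hr z) ⟨l, hl⟩ v hv
      refine ⟨equivShrink C ⟨_, hS.cauchy⟩, ⟨⟨l, hl⟩, v, hv, hr' _ _⟩, ?_⟩
      have h₁ := ih l hlj hl (equivShrink C ⟨_, hS.cauchy⟩)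
      rw [hr'] at h₁
      exact simElem_trans (simElem_trans h₁ (hGv _ (hr z) ⟨l, hl⟩ v hv)) (simElem_symm hv')
  refine ⟨⟨N, equivShrink C ⟨z, hz⟩⟩, ?_, fun j => ?_⟩
  · rw [PointedSystem.isBranching_iff]
    rintro y -
    have hs : SizeLT κ (Σ j : Set.Iio i, {v // M.toSystem.step (r y (next hi j)) v}) :=
      hiκ.sigma hκ fun j => sizeLT_iff.2 (M.str _).2
    refine hs.of_surjective (fun p => ⟨equivShrink C ⟨G (r y) p.1 p.2.1,
      (hG _ (hr y) _ _ p.2.2).cauchy⟩, p.1, p.2.1, p.2.2, hr' _ _⟩) ?_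
    rintro ⟨w, j, v, hv, hw⟩
    refine ⟨⟨j, v, hv⟩, Subtype.ext ?_⟩
    apply (equivShrink C).symm.injective
    apply Subtype.ext
    simpa [r] using hw.symm
  · have := key j (equivShrink C ⟨z, hz⟩)
    rw [hr'] at this
    exact simElem_symm this

/-- Since `|i| < κ`, all terms fit into one `<κ`-branching system, where the sequence becomes a
sequence of elements. -/
theorem seqComplete_of_hasExtensions {κ : WithTop Cardinal.{u}} (hκ : IsInfiniteRegular κ)
    {i : Ordinal.{u}} (hi : Order.IsSuccPrelimit i) (hiκ : SizeLT κ (Set.Iio i))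
    (H : ∀ M : TransitionSystem.{u}, HasExtensions M hi) : SeqComplete κ i := by
  intro x hx hC
  have hX := PointedSystem.isBranching_collect hiκ hx
  choose p hp hp' using PointedSystem.collect_step (x := x)
  let M := (PointedSystem.collect x).reach hX
  let z : Set.Iio i → M.carrier := fun j => ⟨p j, .single (hp j)⟩
  have hz : ∀ j i, PointedSystem.Sim i (M.toPointed (z j)) (x j) := fun j i =>
    simElem_trans (PointedSystem.simElem_reach _ hX (z j) i) (hp' j i)
  have hzC : CauchyIn M.toSystem z := fun k l hkl =>
    ((hz k k.1).trans (hC k l hkl)).trans (hz l k.1).symm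
  obtain ⟨y, hy, hl⟩ := hzC.exists_limit hκ hi hiκ M (H _)
  exact ⟨y, hy, fun j => (hz j j.1).symm.trans (hl j)⟩

/-! ### Extensions for `ω`-cofinal lengths -/

theorem IsOmegaCofinal.hasExtensions {i : Ordinal.{u}} (hω : IsOmegaCofinal i)
    (hi : Order.IsSuccPrelimit i) (M : TransitionSystem.{u}) : HasExtensions M hi := by
  intro z hz j v hv
  obtain ⟨f, hf, hsup⟩ := hω
  have hlt : ∀ n, f n < i := fun n => (hf n.lt_succ_self).trans_le (hsup.1 ⟨_, rfl⟩)
  have hex : ∀ k < i, ∃ n, k ≤ f n := by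
    intro k hk
    by_contra! h
    exact hk.not_ge (hsup.2 (by rintro _ ⟨n, rfl⟩; exact (h n).le))
  obtain ⟨n₀, hn₀⟩ := hex j.1 j.2
  -- A tail of the cofinal sequence that starts at or beyond `j`. The successor `v` is carried along
  -- it, each step matching up to `∼_{g n}`.
  let g : ℕ → Set.Iio i := fun n => ⟨f (n + n₀), hlt _⟩
  have hg : ∀ m n, m ≤ n → g m ≤ g n := fun m n h => hf.monotone (by lia)
  have hjg : j ≤ g 0 := by
    change j.1 ≤ f (0 + n₀)
    rwa [zero_add]
  have hnext : ∀ k l : Set.Iio i, k ≤ l → simElem M M (Order.succ k.1) (z (next hi k))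
    (z (next hi l)) := fun k l h => hz (next hi k) (next hi l)
    (show Order.succ k.1 ≤ Order.succ l.1 from Order.succ_le_succ h)
  have h0 : ∃ w, M.step (z (next hi (g 0))) w ∧ simElem M M j.1 v w :=
    exists_step_of_simElem (Order.lt_succ _) (hnext _ _ hjg) hv
  have hS : ∀ (n : ℕ) (a : {w // M.step (z (next hi (g n))) w}),
      ∃ b : {w // M.step (z (next hi (g (n + 1)))) w}, simElem M M (g n).1 a.1 b.1 := by
    rintro n ⟨a, ha⟩
    obtain ⟨b, hb, hab⟩ := exists_step_of_simElem (Order.lt_succ _)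
      (hnext _ _ (hg n (n + 1) n.le_succ)) ha
    exact ⟨⟨b, hb⟩, hab⟩
  choose S hS using hS
  obtain ⟨w₀, hw₀, hvw₀⟩ := h0
  let w : ∀ n : ℕ, {w // M.step (z (next hi (g n))) w} := fun n =>
    Nat.rec ⟨w₀, hw₀⟩ (fun n a => S n a) n
  have hw : ∀ m n, m ≤ n → simElem M M (g m).1 (w m).1 (w n).1 := by
    intro m n hmn
    induction n, hmn using Nat.le_induction with
    | base => exact simElem_refl ..
    | succ n hmn ih => exact simElem_trans ih (simElem_mono (hg m n hmn) (hS n (w n)))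
  have hgex : ∀ k : Set.Iio i, ∃ n, k ≤ g n := by
    intro k
    obtain ⟨n, hn⟩ := hex k.1 k.2
    exact ⟨n, hn.trans (hf.monotone (by lia))⟩
  choose N hN using hgex
  -- Every other index `k` is filled in by pulling back from a later index `g (N k)`.
  have hex' : ∀ k, ∃ u, M.step (z (next hi k)) u ∧ simElem M M k.1 (w (N k)).1 u := fun k =>
    exists_step_of_simElem (Order.lt_succ _) (simElem_symm (hnext _ _ (hN k))) (w (N k)).2
  choose u hu hu' using hex'
  refine ⟨u, ⟨fun k l hkl => ?_, hu⟩, ?_⟩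
  · have h₁ : simElem M M k.1 (w (N k)).1 (w (N l)).1 := by
      rcases le_total (N k) (N l) with h | h
      · exact simElem_mono (hN k) (hw _ _ h)
      · exact simElem_symm (simElem_mono (hkl.trans (hN l)) (hw _ _ h))
    exact simElem_trans (simElem_trans (simElem_symm (hu' k)) h₁) (simElem_mono hkl (hu' l))
  · exact simElem_trans (simElem_symm (hu' j)) (simElem_trans
      (simElem_symm (simElem_mono hjg (hw 0 (N j) (Nat.zero_le _)))) (simElem_symm hvw₀))

/-! ### Extensions for weakly compact lengths -/

theorem StronglyInaccessible.sizeLT_set {c : Cardinal.{u}} (hc : StronglyInaccessible c)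
    {A : Type v} (hA : SizeLT (c : WithTop Cardinal.{u}) A) :
    SizeLT (c : WithTop Cardinal.{u}) (Set A) := by
  obtain ⟨B, f, hf, hB⟩ := hA
  exact ⟨Set B, _, hf.image_surjective, WithTop.coe_lt_coe.2 (hc B (WithTop.coe_lt_coe.1 hB))⟩

/-- The equivalence relation `∼ₖ` on one system. -/
def simSetoid (M : TransitionSystem.{u}) (k : Ordinal.{u}) : Setoid M.carrier :=
  ⟨simElem M M k, simElem_refl M k, simElem_symm, simElem_trans⟩

theorem isInfiniteRegular_coe {c : Cardinal.{u}} (hc : c.IsRegular) :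
    IsInfiniteRegular (c : WithTop Cardinal.{u}) := by
  intro d hd
  rwa [← WithTop.coe_inj.1 hd]

theorem sizeLT_Iio_of_lt_ord {c : Cardinal.{u}} {k : Ordinal.{u}} (hk : k < c.ord) :
    SizeLT (c : WithTop Cardinal.{u}) (Set.Iio k) :=
  sizeLT_Iio.2 (WithTop.coe_lt_coe.2 (lt_ord.1 hk))

/-- A class modulo `∼_k` is determined by the classes of its successors modulo the `∼_l`, `l < k`.
By induction and regularity there are fewer than `c` of those, and strong inaccessibility bounds the
sets of them. -/
theorem sizeLT_quotient {c : Cardinal.{u}} (hc : c.IsRegular) (hc' : StronglyInaccessible c)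
    (M : TransitionSystem.{u}) {k : Ordinal.{u}} (hk : k < c.ord) :
    SizeLT (c : WithTop Cardinal.{u}) (Quotient (simSetoid M k)) := by
  induction k using WellFoundedLT.induction with
  | ind k ih =>
  have h : SizeLT (c : WithTop Cardinal.{u}) (Σ l : Set.Iio k, Quotient (simSetoid M l.1)) :=
    (sizeLT_Iio_of_lt_ord hk).sigma (isInfiniteRegular_coe hc)
      fun l => ih l.1 l.2 (lt_trans (Set.mem_Iio.1 l.2) hk)
  refine (hc'.sizeLT_set h).of_injective
    (fun q => {p | ∃ y, M.step q.out y ∧ Quotient.mk _ y = p.2}) ?_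
  intro q q' hq
  have hq := Set.ext_iff.1 hq
  rw [← Quotient.out_eq q, ← Quotient.out_eq q']
  refine Quotient.sound ((simElem_iff ..).2 fun l hl => ⟨fun y hy => ?_, fun y hy => ?_⟩)
  · obtain ⟨y', hy', e⟩ := (hq ⟨⟨l, hl⟩, Quotient.mk _ y⟩).1 ⟨y, hy, rfl⟩
    exact ⟨y', hy', simElem_symm (Quotient.exact e)⟩
  · obtain ⟨y', hy', e⟩ := (hq ⟨⟨l, hl⟩, Quotient.mk _ y⟩).2 ⟨y, hy, rfl⟩
    exact ⟨y', hy', Quotient.exact e⟩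

section ExtensionTree

variable {M : TransitionSystem.{u}} {i : Ordinal.{u}} (hi : Order.IsSuccPrelimit i)
  {z : Set.Iio i → M.carrier} (hz : CauchyIn M z) (j : Set.Iio i) (v : M.carrier)

/-- `w` is a successor of the `k`-th member of `z` (up to a shift), compatible with the successor
`v` of the `j`-th member. -/
def IsNode (z : Set.Iio i → M.carrier) (k : Set.Iio i) (w : M.carrier) : Prop :=
  M.step (z (next hi k)) w ∧ simElem M M (min k j).1 w v

include hz in
theorem CauchyIn.next {k l : Set.Iio i} {m : Ordinal.{u}} (hk : m ≤ k.1) (hl : m ≤ l.1) :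
    simElem M M (Order.succ m) (z (next hi k)) (z (next hi l)) := by
  rcases le_total k l with h | h
  · exact simElem_mono (Order.succ_le_succ hk) (hz (Ghost.next hi k) (Ghost.next hi l)
      (show Order.succ k.1 ≤ Order.succ l.1 from Order.succ_le_succ h))
  · exact simElem_symm (simElem_mono (Order.succ_le_succ hl) (hz (Ghost.next hi l) (Ghost.next hi k)
      (show Order.succ l.1 ≤ Order.succ k.1 from Order.succ_le_succ h)))

include hz in
theorem IsNode.restrict {k l : Set.Iio i} (hlk : l ≤ k) {w : M.carrier}
    (hw : IsNode hi j v z k w) : ∃ w', IsNode hi j v z l w' ∧ simElem M M l.1 w w' := by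
  obtain ⟨w', hw', h⟩ := exists_step_of_simElem (Order.lt_succ _)
    (hz.next hi (show l.1 ≤ k.1 from hlk) le_rfl) hw.1
  have h₁ : min l j ≤ min k j := min_le_min_right _ hlk
  exact ⟨w', ⟨hw', simElem_trans (simElem_symm (simElem_mono (min_le_left l j) h))
    (simElem_mono h₁ hw.2)⟩, h⟩

include hz in
theorem IsNode.extend (hv : M.step (z (Ghost.next hi j)) v) {k l : Set.Iio i} (hlk : l ≤ k)
    {w : M.carrier} (hw : IsNode hi j v z l w) :
    ∃ w', IsNode hi j v z k w' ∧ simElem M M l.1 w' w := by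
  rcases le_total j l with h | h
  · obtain ⟨w', hw', h'⟩ := exists_step_of_simElem (Order.lt_succ _)
      (hz.next hi le_rfl (show l.1 ≤ k.1 from hlk)) hw.1
    have h₂ := hw.2
    rw [min_eq_right h] at h₂
    refine ⟨w', ⟨hw', ?_⟩, simElem_symm h'⟩
    rw [min_eq_right (h.trans hlk)]
    exact simElem_trans (simElem_symm (simElem_mono (show j.1 ≤ l.1 from h) h')) h₂
  -- Here `w` may know too little about `v`, so the extension starts from `v`, which agrees with `w`
  -- up to `∼_l`.
  · obtain ⟨w', hw', h'⟩ := exists_step_of_simElem (Order.lt_succ _)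
      (hz.next hi (show (min k j).1 ≤ j.1 from min_le_right k j)
        (show (min k j).1 ≤ k.1 from min_le_left k j)) hv
    have h₂ := hw.2
    rw [min_eq_left h] at h₂
    have h₃ : l ≤ min k j := le_min hlk h
    exact ⟨w', ⟨hw', simElem_symm h'⟩, simElem_symm (simElem_trans h₂
      (simElem_mono (show l.1 ≤ (min k j).1 from h₃) h'))⟩

/-- The tree of possible extensions of `v` to a sequence of successors of the members of `z`. -/
def extensionTree : InverseChain.{u, u + 1} (Set.Iio i) where
  level k := {q : Quotient (simSetoid M k.1) // ∃ w, IsNode hi j v z k w ∧ Quotient.mk _ w = q}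
  map {l k} h q := ⟨Quotient.map' id (fun _ _ e => simElem_mono h e) q.1, by
    obtain ⟨_, w, hw, rfl⟩ := q
    obtain ⟨w', hw', e⟩ := hw.restrict hi hz j v h
    exact ⟨w', hw', Quotient.sound (simElem_symm e)⟩⟩
  map_refl := by
    rintro k ⟨_, w, hw, rfl⟩
    rfl
  map_map := by
    rintro k l m h h' ⟨_, w, hw, rfl⟩
    rfl

theorem extensionTree_isTidy (hv : M.step (z (Ghost.next hi j)) v) :
    (extensionTree hi hz j v).IsTidy where
  surj := by
    rintro l k h ⟨_, w, hw, rfl⟩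
    obtain ⟨w', hw', e⟩ := hw.extend hi hz j v hv h
    exact ⟨⟨_, w', hw', rfl⟩, Subtype.ext (Quotient.sound e)⟩
  limit := by
    rintro k hk ⟨_, w, hw, rfl⟩ ⟨_, w', hw', rfl⟩ h
    have hk' : Order.IsSuccPrelimit k.1 := by
      intro a ha
      refine hk ⟨a, ha.1.trans k.2⟩ ⟨ha.1, fun b hb hb' => ha.2 hb hb'⟩
    refine Subtype.ext (Quotient.sound ((simElem_limit _ _ hk' _ _).2 fun l hl => ?_))
    exact Quotient.exact (congrArg Subtype.val (h ⟨l, hl.trans k.2⟩ hl))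
  root := by
    let b : Set.Iio i := ⟨0, lt_of_le_of_lt zero_le (Set.mem_Iio.1 j.2)⟩
    have hb : ∀ k, b ≤ k := fun k => (zero_le : (0 : Ordinal) ≤ k.1)
    refine ⟨b, hb, ?_⟩
    have hj : IsNode hi j v z j v := ⟨hv, simElem_refl ..⟩
    obtain ⟨w, hw, -⟩ := hj.restrict hi hz j v (hb j)
    exact ⟨⟨_, w, hw, rfl⟩⟩

end ExtensionTree

/-- Representatives of a full branch of the extension tree form the required sequence; the node
condition at `j` makes it pass through `v`. -/
theorem hasExtensions_of_treeProperty {c : Cardinal.{u}} (hc : c.IsRegular)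
    (hc' : StronglyInaccessible c) (ht : TreeProperty c) (hi : Order.IsSuccPrelimit c.ord)
    (M : TransitionSystem.{u}) : HasExtensions M hi := by
  intro z hz j v hv
  obtain ⟨x, hx⟩ := ht (extensionTree hi hz j v) (extensionTree_isTidy hi hz j v hv) fun k =>
    WithTop.coe_lt_coe.1 (sizeLT_iff.1 ((sizeLT_quotient hc hc' M k.2).subtype _))
  choose w hw hwx using fun k => (x k).2
  refine ⟨w, ⟨fun k l hkl => ?_, fun k => (hw k).1⟩, ?_⟩
  · have h := congrArg Subtype.val (hx k l hkl)
    rw [← Subtype.coe_eta (x l) (x l).2] at h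
    simp only [extensionTree, ← hwx] at h
    exact simElem_symm (Quotient.exact (s := simSetoid M k.1) h)
  · have h := (hw j).2
    rwa [min_self] at h

/-! ### Sufficiency of the condition -/

theorem isSuccPrelimit_ord {c : Cardinal.{u}} (hc : c.IsRegular) : Order.IsSuccPrelimit c.ord :=
  (isSuccLimit_ord hc.aleph0_le).isSuccPrelimit

theorem add_omega0_le_iff_lt {a i : Ordinal.{u}} (hi : Order.IsSuccPrelimit i) :
    a + Ordinal.omega0 ≤ i ↔ a < i := by
  constructor
  · exact fun h => lt_of_lt_of_le (by simp [Ordinal.omega0_pos]) h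
  · intro h
    rw [Ordinal.add_le_iff Ordinal.omega0_ne_zero]
    intro b hb
    obtain ⟨n, rfl⟩ := Ordinal.lt_omega0.1 hb
    induction n with
    | zero => simpa using h
    | succ n ih =>
      rw [Nat.cast_succ, ← add_assoc, ← Order.succ_eq_add_one]
      exact hi.succ_lt (ih (Ordinal.natCast_lt_omega0 n))

/-- The size of a limit that is neither `κ` nor beyond `κ + ω`. -/
theorem sizeLT_of_not_geAddOmega {κ : WithTop Cardinal.{u}} {i : Ordinal.{u}}
    (hi : Order.IsSuccPrelimit i) (h₁ : ¬ EqKappa κ i) (h₂ : ¬ GeAddOmega κ i) :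
    SizeLT κ (Set.Iio i) := by
  rw [sizeLT_Iio]
  induction κ using WithTop.recTopCoe with
  | top => exact WithTop.coe_lt_top _
  | coe c =>
    rw [WithTop.coe_lt_coe, ← lt_ord]
    by_contra! h
    rcases h.eq_or_lt with h | h
    · exact h₁ ⟨c, rfl, h.symm⟩
    · exact h₂ ⟨c, rfl, (add_omega0_le_iff_lt hi).2 h⟩

theorem IsGoodLimit.seqComplete {κ : WithTop Cardinal.{u}} (hκ : IsInfiniteRegular κ)
    {i : Ordinal.{u}} (hi : Order.IsSuccPrelimit i) (h : IsGoodLimit κ i) : SeqComplete κ i := by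
  by_cases hg : GeAddOmega κ i
  · obtain ⟨c, rfl, hc⟩ := hg
    exact seqComplete_of_ord_lt (hκ c rfl) ((add_omega0_le_iff_lt hi).1 hc)
  refine seqComplete_of_hasExtensions hκ hi (sizeLT_of_not_geAddOmega hi h.1 hg) fun M => ?_
  rcases h.2 with rfl | h | ⟨c, rfl, hc, hc', ht⟩ | h
  · exact fun z hz j => absurd (Set.mem_Iio.1 j.2) not_lt_zero
  · exact h.hasExtensions hi M
  · exact hasExtensions_of_treeProperty hc hc' ht hi M
  · exact absurd h hg

open PointedSystem

/-! ### Incomplete lengths -/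

/-- The ordinals `j < c` form a Cauchy sequence. A limit needs, for each `j`, a successor that looks
like `j`, and these are pairwise distinct. -/
theorem not_seqComplete_ord {c : Cardinal.{u}} (hc : c.IsRegular) :
    ¬ SeqComplete (c : WithTop Cardinal.{u}) c.ord := by
  intro H
  obtain ⟨y, hy, hl⟩ := H (fun j => ordSys j.1)
    (fun j => isBranching_ordSys (sizeLT_Iio_of_lt_ord j.2))
    (fun j k h => sim_ordSys_of_le le_rfl h)
  have hi := isSuccPrelimit_ord hc
  have hex : ∀ j : Set.Iio c.ord, ∃ z, y.step y.point z ∧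
      Sim (Order.succ j.1) (ordSys j.1) (y.pt z) := by
    intro j
    -- Stage `j + 2` is used so that the successor matches `j` up to `∼_{j+1}`, which separates `j`
    -- from all other ordinals.
    have h : Sim _ (ordSys (Order.succ (Order.succ j.1))) y := hl (next hi (next hi j))
    rw [ordSys] at h
    exact h.exists_step_of_collect (Order.lt_succ _)
      ⟨j.1, show j.1 < Order.succ (Order.succ j.1) from (Order.lt_succ _).trans (Order.lt_succ _)⟩
  choose z hz hz' using hex
  have hinj : ∀ j k, j ≤ k → z j = z k → j = k := by
    intro j k hjk e
    have h := hz' k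
    rw [← e] at h
    exact Subtype.ext (eq_of_sim_ordSys ((hz' j).trans
      (h.mono (Order.succ_le_succ hjk)).symm) (Order.lt_succ j.1))
  have hs : SizeLT (c : WithTop Cardinal.{u}) (Set.Iio c.ord) :=
    (isBranching_iff.1 hy _ .refl).of_injective (fun j => ⟨z j, hz j⟩) fun j k e => by
      have e := congrArg Subtype.val e
      rcases le_total j k with h | h
      · exact hinj _ _ h e
      · exact (hinj _ _ h e.symm).symm
  rw [sizeLT_Iio, card_ord] at hs
  exact lt_irrefl _ hs

/-- An inverse system of sets of pointed systems without a branch gives a Cauchy sequence without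
a limit. -/
theorem not_seqComplete_of_family {κ : WithTop Cardinal.{u}} {i : Ordinal.{u}}
    (hi : Order.IsSuccPrelimit i) (h0 : i ≠ 0) {ι : Set.Iio i → Type v} [∀ j, Small.{u} (ι j)]
    [∀ j, Nonempty (ι j)] (t : ∀ j, ι j → PointedSystem.{u}) (hι : ∀ j, SizeLT κ (ι j))
    (ht : ∀ j a, (t j a).IsBranching κ)
    (hres : ∀ k j, k ≤ j → ∀ a, ∃ b, Sim k.1 (t k b) (t j a))
    (hext : ∀ k j, k ≤ j → ∀ b, ∃ a, Sim k.1 (t k b) (t j a))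
    (hbranch : ∀ z : PointedSystem.{u}, ¬ ∀ j, ∃ a, Sim j.1 (t j a) z) : ¬ SeqComplete κ i := by
  intro H
  obtain ⟨y, -, hl⟩ := H (fun j => collect (t j))
    (fun j => isBranching_collect (hι j) (ht j)) (fun k j h => sim_collect_iff.2 fun l hl =>
      ⟨fun b => (hext k j h b).imp fun a ha => ha.mono hl.le,
        fun a => (hres k j h a).imp fun b hb => hb.mono hl.le⟩)
  -- Stage `1` already gives the limit a successor `z`; stage `j + 1` then places `z` near a member
  -- of the `j`-th set, for every `j`.
  let o : Set.Iio i := ⟨0, pos_iff_ne_zero.2 h0⟩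
  obtain ⟨z, hz, -⟩ := (hl (next hi o)).exists_step_of_collect (Order.lt_succ _)
    (Classical.arbitrary _)
  refine hbranch (y.pt z) fun j => ?_
  obtain ⟨a, ha⟩ := (hl (next hi j)).exists_of_collect (Order.lt_succ j.1) hz
  obtain ⟨b, hb⟩ := hres j (next hi j) (Order.le_succ j.1) a
  exact ⟨b, hb.trans ha⟩

/-- Passing repeatedly to a larger element of `B` gives an increasing sequence. Were it bounded
below `i`, infinitely many elements of `B` would lie below one of them. -/
theorem isOmegaCofinal_of_finite_initial {i : Ordinal.{u}} (hi : Order.IsSuccPrelimit i)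
    (h0 : i ≠ 0) {B : Set Ordinal.{u}} (hB : ∀ b ∈ B, b < i) (hcof : ∀ k < i, ∃ b ∈ B, k ≤ b)
    (hfin : ∀ b ∈ B, {a ∈ B | a < b}.Finite) : IsOmegaCofinal i := by
  have hlt : ∀ k < i, ∃ b ∈ B, k < b := fun k hk =>
    (hcof _ (hi.succ_lt hk)).imp fun b hb => ⟨hb.1, Order.succ_le_iff.1 hb.2⟩
  obtain ⟨b₀, hb₀, -⟩ := hcof 0 (pos_iff_ne_zero.2 h0)
  choose! s hsB hs using hlt
  let f : ℕ → B := fun n => Nat.rec ⟨b₀, hb₀⟩ (fun _ b => ⟨s b.1, hsB _ (hB _ b.2)⟩) n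
  have hf : StrictMono fun n => (f n).1 := strictMono_nat_of_lt_succ fun n => hs _ (hB _ (f n).2)
  refine ⟨_, hf, ?_, ?_⟩
  · rintro _ ⟨n, rfl⟩
    exact (hB _ (f n).2).le
  · intro u hu
    by_contra! h
    refine Set.infinite_range_of_injective hf.injective ((hfin _ (hsB u h)).subset ?_)
    rintro _ ⟨n, rfl⟩
    exact ⟨(f n).2, (hu ⟨n, rfl⟩).trans_lt (hs u h)⟩

/-! #### Lengths of small cofinality -/

section SmallCofinality

variable {β : Ordinal.{u}} {C : Type u} (E : C → Set (Set.Iio β))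

instance {α : Type v} [Small.{u} α] : Small.{u} (Option α) :=
  ⟨⟨Option (Shrink.{u} α), ⟨Equiv.optionCongr (equivShrink α)⟩⟩⟩

/-- A system coding a pair of an index `c` and an ordinal `ξ ≥ β`. -/
noncomputable def pairSys (c : C) (ξ : Ordinal.{u}) : PointedSystem.{u} :=
  collect fun b : Option (E c) => b.elim (ordSys ξ) fun b => ordSys b.1.1

/-- As `m ≥ β`, the relation `∼_m` identifies ordinals below `β` exactly and never confuses them
with `ξ` or `ξ'`. So `E c`, hence `c`, can be read off, and `ξ` can only be matched with `ξ'`. -/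
theorem eq_of_sim_pairSys (hE : Function.Injective E) {c c' : C} {ξ ξ' m : Ordinal.{u}}
    (hm : β ≤ m) (hξ : β ≤ ξ) (hξ' : β ≤ ξ')
    (h : Sim (Order.succ m) (pairSys E c ξ) (pairSys E c' ξ')) :
    c = c' ∧ Sim m (ordSys ξ) (ordSys ξ') := by
  have sub : ∀ (c c' : C) (ξ ξ' : Ordinal.{u}), β ≤ ξ' →
      Sim (Order.succ m) (pairSys E c ξ) (pairSys E c' ξ') → E c ⊆ E c' := by
    intro c c' ξ ξ' hξ' h b hb
    obtain ⟨b', h⟩ := (sim_collect_iff.1 h m (Order.lt_succ m)).1 (some ⟨b, hb⟩)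
    have e := fun (o : Ordinal.{u}) (h : Sim m (ordSys b.1) (ordSys o)) =>
      eq_of_sim_ordSys h (lt_of_lt_of_le b.2 hm)
    cases b' with
    | none => exact absurd (e ξ' h) (lt_of_lt_of_le b.2 hξ').ne
    | some b' =>
      rw [Subtype.ext (e b'.1.1 h)]
      exact b'.2
  refine ⟨hE ((sub _ _ _ _ hξ' h).antisymm (sub _ _ _ _ hξ h.symm)), ?_⟩
  obtain ⟨b', h⟩ := (sim_collect_iff.1 h m (Order.lt_succ m)).1 none
  cases b' with
  | none => exact h
  | some b' =>
    have hb : b'.1.1 < β := b'.1.2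
    exact absurd (eq_of_sim_ordSys (a := b'.1.1) h.symm (hb.trans_le hm)) (hb.trans_le hξ).ne

theorem sim_pairSys {c : C} {ξ ξ' m : Ordinal.{u}} (h : Sim m (ordSys ξ) (ordSys ξ')) :
    Sim m (pairSys E c ξ) (pairSys E c ξ') := by
  refine sim_collect_of_forall ?_
  rintro (_ | b)
  · exact h
  · exact .refl _ _

/-- The system coding a function from indices to ordinals. -/
noncomputable def graphSys (F : C → Ordinal.{u}) : PointedSystem.{u} :=
  collect fun c => pairSys E c (F c)

/-- Two stages are spent: one from the graph to a pair, one from the pair to its ordinal. -/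
theorem sim_of_sim_graphSys (hE : Function.Injective E) {F F' : C → Ordinal.{u}}
    {m : Ordinal.{u}} (hm : β ≤ m) (hF : ∀ c, β ≤ F c) (hF' : ∀ c, β ≤ F' c)
    (h : Sim (Order.succ (Order.succ m)) (graphSys E F) (graphSys E F')) (c : C) :
    F c = F' c ∨ m ≤ F c ∧ m ≤ F' c := by
  obtain ⟨c', h⟩ := (sim_collect_iff.1 h _ (Order.lt_succ _)).1 c
  obtain ⟨rfl, h⟩ := eq_of_sim_pairSys E hE hm (hF _) (hF' _) h
  exact sim_ordSys_iff.1 h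

theorem isBranching_graphSys {κ : WithTop Cardinal.{u}} (hκ : IsInfiniteRegular κ)
    {i : Ordinal.{u}} (hi : SizeLT κ (Set.Iio i)) (hβ : β ≤ i) (hC : SizeLT κ C)
    {F : C → Ordinal.{u}} (hF : ∀ c, F c ≤ i) : (graphSys E F).IsBranching κ := by
  have hle : ∀ o ≤ i, SizeLT κ (Set.Iio o) := fun o ho =>
    hi.of_injective (Set.inclusion (Set.Iio_subset_Iio ho)) (Set.inclusion_injective _)
  refine isBranching_collect hC fun c => isBranching_collect
    (((hle β hβ).subtype _).option hκ) ?_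
  rintro (_ | b)
  · exact isBranching_ordSys (hle _ (hF c))
  · exact isBranching_ordSys (hle _ ((le_of_lt b.1.2).trans hβ))

variable [LinearOrder C] (o : C → Ordinal.{u}) (i : Ordinal.{u})

open Classical in
/-- Each element of the finite set `s` is mapped to its predecessor in `s` (to `β` if there is
none), the other indices to `i`. -/
noncomputable def predFun (β : Ordinal.{u}) (s : Finset C) (c : C) : Ordinal.{u} :=
  if c ∈ s then β ⊔ (s.filter (· < c)).sup o else i

variable {o i}

theorem predFun_lt_iff {s : Finset C} {c : C} {m : Ordinal.{u}} (hm : m ≤ i) (hβ : β < m) :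
    predFun o i β s c < m ↔ c ∈ s ∧ ∀ d ∈ s, d < c → o d < m := by
  unfold predFun
  split_ifs with h
  · simp [h, hβ, Finset.sup_lt_iff (bot_le.trans_lt hβ)]
  · simp [h, hm]

theorem le_predFun (hβ : β ≤ i) (s : Finset C) (c : C) : β ≤ predFun o i β s c := by
  unfold predFun
  split_ifs
  · exact le_sup_left
  · exact hβ

theorem predFun_le (hβ : β ≤ i) (ho : ∀ c, o c < i) (s : Finset C) (c : C) :
    predFun o i β s c ≤ i := by
  unfold predFun
  split_ifs
  · exact sup_le hβ (Finset.sup_le fun d _ => (ho d).le)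
  · exact le_rfl

theorem le_predFun_of_mem {s : Finset C} {c d : C} (hd : d ∈ s) (hdc : d < c) (ho : ∀ c, o c < i) :
    o d ≤ predFun o i β s c := by
  unfold predFun
  split_ifs
  · exact le_sup_of_le_right (Finset.le_sup (f := o) (Finset.mem_filter.2 ⟨hd, hdc⟩))
  · exact (ho d).le

theorem predFun_insert [DecidableEq C] {s : Finset C} {c d : C} (hd : ∀ a ∈ s, a < d)
    (hcd : c ≠ d) : predFun o i β (insert d s) c = predFun o i β s c := by
  unfold predFun
  by_cases h : c ∈ s
  · rw [if_pos h, if_pos (Finset.mem_insert_of_mem h), Finset.filter_insert,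
      if_neg (hd c h).not_gt]
  · rw [if_neg h, if_neg (by simp [h, hcd])]

variable {E}

/-- Stage `j` consists of the finite subsets of `C` that reach `j`, coded by their predecessor
functions. Adding a new largest element `d` changes only the value at `d`, from `i` to an ordinal `≥
k`, which `∼_k` does not see. A branch would determine a cofinal set with finite initial segments.
-/
theorem not_seqComplete_of_injective {κ : WithTop Cardinal.{u}} (hκ : IsInfiniteRegular κ)
    (hiκ : SizeLT κ (Set.Iio i)) (hi : Order.IsSuccPrelimit i) (h0 : i ≠ 0) (hβ : β < i)
    (ho : StrictMono o) (hoi : ∀ c, o c < i) (hcof : ∀ k < i, ∃ c, k ≤ o c)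
    (hE : Function.Injective E) (hω : ¬ IsOmegaCofinal i) : ¬ SeqComplete κ i := by
  classical
  have hC : SizeLT κ C := hiκ.of_injective (fun c => ⟨o c, hoi c⟩) fun c d h =>
    ho.injective (congrArg Subtype.val h)
  have hfC : SizeLT κ (Finset C) := by
    rcases finite_or_infinite C with h | h
    · exact sizeLT_of_finite hκ
    · rw [sizeLT_iff, mk_finset_of_infinite, ← sizeLT_iff]
      exact hC
  have hgt : ∀ k < i, ∃ c, k < o c := fun k hk =>
    (hcof _ (hi.succ_lt hk)).imp fun c hc => Order.succ_le_iff.1 hc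
  have : ∀ j : Set.Iio i, Nonempty {s : Finset C // ∃ c ∈ s, j.1 ≤ o c} := by
    intro j
    obtain ⟨c, hc⟩ := hcof j.1 j.2
    exact ⟨{c}, c, by simp, hc⟩
  refine not_seqComplete_of_family hi h0 (ι := fun j => {s : Finset C // ∃ c ∈ s, j.1 ≤ o c})
    (fun j s => graphSys E (predFun o i β s.1)) (fun j => hfC.subtype _)
    (fun j s => isBranching_graphSys E hκ hiκ hβ.le hC (predFun_le hβ.le hoi s.1)) ?_ ?_ ?_
  · rintro k j hkj ⟨s, c, hc, hj⟩
    exact ⟨⟨s, c, hc, le_trans (show k.1 ≤ j.1 from hkj) hj⟩, .refl _ _⟩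
  · rintro k j hkj ⟨s, c, hc, hk⟩
    obtain ⟨d, hd⟩ := hgt (j.1 ⊔ s.sup o)
      (max_lt j.2 ((Finset.sup_lt_iff (bot_le.trans_lt hβ)).2 fun a _ => hoi a))
    have hsd : ∀ a ∈ s, a < d := fun a ha => ho.lt_iff_lt.1
      ((le_sup_of_le_right (Finset.le_sup (f := o) ha)).trans_lt hd)
    refine ⟨⟨insert d s, d, Finset.mem_insert_self _ _, le_sup_left.trans hd.le⟩,
      sim_collect_of_forall fun e => sim_pairSys E ?_⟩
    by_cases hed : e = d
    · subst hed
      refine sim_ordSys_of_le ?_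
        (hk.trans (le_predFun_of_mem (Finset.mem_insert_of_mem hc) (hsd c hc) hoi))
      exact hk.trans (le_predFun_of_mem hc (hsd c hc) hoi)
    · dsimp only
      rw [predFun_insert hsd hed]
      exact .refl _ _
  · intro z hz
    choose s hs using hz
    have hsim : ∀ k j, k ≤ j → Sim k.1 (graphSys E (predFun o i β (s k).1))
        (graphSys E (predFun o i β (s j).1)) := fun k j h =>
      (hs k).trans ((hs j).mono (show k.1 ≤ j.1 from h)).symm
    -- The shift by two pays for the steps from graph to pair to ordinal.
    let σ : Set.Iio i → Finset C := fun m => (s (next hi (next hi m))).1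
    have hσ : ∀ m n : Set.Iio i, m ≤ n → β < m.1 → ∀ c,
        predFun o i β (σ m) c = predFun o i β (σ n) c ∨
          m.1 ≤ predFun o i β (σ m) c ∧ m.1 ≤ predFun o i β (σ n) c := by
      intro m n hmn hm
      refine sim_of_sim_graphSys E hE hm.le (le_predFun hβ.le _) (le_predFun hβ.le _)
        (hsim (next hi (next hi m)) (next hi (next hi n)) ?_)
      exact show Order.succ (Order.succ m.1) ≤ Order.succ (Order.succ n.1) from
        Order.succ_le_succ (Order.succ_le_succ hmn)
    refine hω (isOmegaCofinal_of_finite_initial hi h0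
      (B := {b | ∃ (c : C) (m : Set.Iio i), o c = b ∧ β < m.1 ∧
        predFun o i β (σ m) c < m.1}) ?_ ?_ ?_)
    · rintro _ ⟨c, -, rfl, -⟩
      exact hoi c
    · intro k hk
      -- The least element of `σ m` at or beyond `m` has all its predecessors below `m`, so its
      -- value is visible at stage `m`.
      let m : Set.Iio i := ⟨k ⊔ Order.succ β, max_lt hk (hi.succ_lt hβ)⟩
      have hβm : β < m.1 := (Order.lt_succ β).trans_le le_sup_right
      have hne : ((σ m).filter fun c => m.1 ≤ o c).Nonempty := by
        obtain ⟨c, hc, hc'⟩ := (s (next hi (next hi m))).2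
        exact ⟨c, Finset.mem_filter.2 ⟨hc,
          ((Order.le_succ m.1).trans (Order.le_succ _)).trans hc'⟩⟩
      have hc := Finset.min'_mem _ hne
      have hmin := fun d => Finset.min'_le ((σ m).filter fun c => m.1 ≤ o c) d
      set c := Finset.min' _ hne
      rw [Finset.mem_filter] at hc
      refine ⟨o c, ⟨c, m, rfl, hβm, (predFun_lt_iff m.2.le hβm).2 ⟨hc.1, fun d hd hdc => ?_⟩⟩,
        le_sup_left.trans hc.2⟩
      by_contra! h
      exact hdc.not_ge (hmin d (Finset.mem_filter.2 ⟨hd, h⟩))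
    · rintro _ ⟨c, m, rfl, hm, hc⟩
      refine ((σ m).finite_toSet.image o).subset ?_
      rintro _ ⟨⟨c', m', rfl, hm', hc'⟩, hlt⟩
      have hcc := ho.lt_iff_lt.1 hlt
      refine ⟨c', ?_, rfl⟩
      -- At the common stage, `c'` precedes `c` in `σ n`, so `o c' < m` and the value at `c'` is
      -- below `m` too. This transfers back to `σ m`, so `c'` lies in that finite set.
      let n := m ⊔ m'
      have h₁ : predFun o i β (σ n) c < m.1 := by
        rcases hσ m n le_sup_left hm c with h | h
        · rwa [← h]
        · exact absurd hc h.1.not_gt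
      have h₂ : predFun o i β (σ n) c' < m'.1 := by
        rcases hσ m' n le_sup_right hm' c' with h | h
        · rwa [← h]
        · exact absurd hc' h.1.not_gt
      rw [predFun_lt_iff (le_of_lt m.2) hm] at h₁
      have hc'n := ((predFun_lt_iff (le_of_lt m'.2) hm').1 h₂).1
      have hlt' := h₁.2 c' hc'n hcc
      have h₃ : predFun o i β (σ n) c' < m.1 := (predFun_lt_iff (le_of_lt m.2) hm).2
        ⟨hc'n, fun d _ hdc => (ho hdc).trans hlt'⟩
      have h₄ : predFun o i β (σ m) c' < m.1 := by
        rcases hσ m n le_sup_left hm c' with h | h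
        · rwa [h]
        · exact absurd h₃ h.2.not_gt
      exact ((predFun_lt_iff (le_of_lt m.2) hm).1 h₄).1

end SmallCofinality

/-- A cofinal set of size at most `2^|β|` can be labelled injectively by subsets of `β`. -/
theorem not_seqComplete_of_cof_le {κ : WithTop Cardinal.{u}} (hκ : IsInfiniteRegular κ)
    {i β : Ordinal.{u}} (hiκ : SizeLT κ (Set.Iio i)) (hi : Order.IsSuccPrelimit i) (h0 : i ≠ 0)
    (hβ : β < i) (hcof : i.cof ≤ 2 ^ β.card) (hω : ¬ IsOmegaCofinal i) : ¬ SeqComplete κ i := by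
  obtain ⟨S, hS, hS'⟩ := Order.exists_cof_eq i.ToType
  rw [Ordinal.cof_toType] at hS'
  let o : i.ToType → Ordinal.{u} := fun c => (Ordinal.ToType.mk.symm c).1
  have ho : StrictMono o := fun c d h => (Ordinal.ToType.mk (o := i)).symm.strictMono h
  let C := {c : S // β ≤ o c.1}
  have hC : #C ≤ #(Set β.ToType) := by
    rw [mk_set, mk_toType]
    exact (mk_subtype_le _).trans (hS'.trans_le hcof)
  obtain ⟨e⟩ := hC
  refine not_seqComplete_of_injective (C := C) (o := fun c => o c.1.1)
    (E := fun c => Ordinal.ToType.mk.symm '' e c) hκ hiκ hi h0 hβ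
    (fun c d h => ho h) (fun c => (Ordinal.ToType.mk.symm c.1.1).2) ?_
    ((Ordinal.ToType.mk.symm.injective.image_injective).comp e.injective) hω
  intro k hk
  obtain ⟨c, hc, hle⟩ := hS (Ordinal.ToType.mk ⟨k ⊔ β, max_lt hk hβ⟩)
  have hle' : k ⊔ β ≤ o c := by
    have := ho.monotone hle
    simpa [o] using this
  exact ⟨⟨⟨c, hc⟩, le_sup_right.trans hle'⟩, le_sup_left.trans hle'⟩

/-! #### Regular lengths without the tree property -/

/-- Pairwise distinct ordinals below `c` for the nodes of a tree with levels of size `<c`, such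
that those of the `k`-th level are at least `k` and bounded below `c`. -/
theorem exists_positions {c : Cardinal.{u}} (hc : c.IsRegular) (L : Set.Iio c.ord → Type u)
    [∀ k, Nonempty (L k)] (hL : ∀ k, #(L k) < c) :
    ∃ pos : ∀ k, L k → Ordinal.{u}, (∀ k d, k.1 ≤ pos k d) ∧
      (∀ k, ∃ b < c.ord, ∀ d, pos k d < b) ∧
      ∀ k d k' d', pos k d = pos k' d' → (⟨k, d⟩ : Σ k, L k) = ⟨k', d'⟩ := by
  classical
  -- `s k` is the length of a block of positions for level `k`; the default `1` keeps it positive,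
  -- so that the block starts `g k` increase strictly.
  let s : Ordinal.{u} → Ordinal.{u} := fun k => if h : k < c.ord then (#(L ⟨k, h⟩)).ord else 1
  have hs0 : ∀ k, 0 < s k := by
    intro k
    dsimp only [s]
    split_ifs with h
    · rw [lt_ord, Ordinal.card_zero]
      exact mk_ne_zero _ |>.bot_lt
    · exact zero_lt_one
  have hsc : ∀ k < c.ord, s k < c.ord := by
    intro k h
    dsimp only [s]
    rw [dif_pos h]
    exact ord_lt_ord.2 (hL _)
  let g : Ordinal.{u} → Ordinal.{u} := WellFoundedLT.fix fun k g =>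
    ⨆ l : Set.Iio k, g l.1 l.2 + s l.1
  have hg : ∀ k, g k = ⨆ l : Set.Iio k, (g l.1 + s l.1) := fun k => WellFoundedLT.fix_eq _ k
  have hle : ∀ l k, l < k → g l + s l ≤ g k := by
    intro l k h
    rw [hg k]
    exact Ordinal.le_iSup (fun l : Set.Iio k => g l.1 + s l.1) ⟨l, h⟩
  have hmono : StrictMono g := fun l k h =>
    lt_of_lt_of_le (lt_add_of_pos_right _ (hs0 l)) (hle l k h)
  have hadd : ∀ a < c.ord, ∀ b < c.ord, a + b < c.ord := fun a ha b hb =>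
    Ordinal.isPrincipal_add_ord hc.aleph0_le ha hb
  have hgc : ∀ k < c.ord, g k < c.ord := by
    intro k hk
    induction k using WellFoundedLT.induction with
    | ind k ih =>
    rw [hg k]
    refine Ordinal.lift_iSup_lt_of_lt_cof ?_ fun l =>
      hadd _ (ih l.1 l.2 (lt_trans (Set.mem_Iio.1 l.2) hk)) _ (hsc _ (lt_trans (Set.mem_Iio.1 l.2) hk))
    rw [← Ordinal.lift_cof, hc.cof_ord, lift_id'.{u, u + 1}, Cardinal.mk_Iio_ordinal, lift_lt]
    exact lt_ord.1 hk
  let e : ∀ k, L k ≃ (#(L k)).ord.ToType := fun k => (Cardinal.eq.1 (mk_ord_toType _)).some.symm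
  let lab : ∀ k, L k → Ordinal.{u} := fun k d => (Ordinal.ToType.mk.symm (e k d)).1
  have hlab : ∀ k d, lab k d < s k.1 := by
    intro k d
    dsimp only [s]
    rw [dif_pos (Set.mem_Iio.1 k.2)]
    exact (Ordinal.ToType.mk.symm (e k d)).2
  have hlab' : ∀ k, Function.Injective (lab k) := fun k d d' h =>
    (e k).injective (Ordinal.ToType.mk.symm.injective (Subtype.ext h))
  have hlt : ∀ k d k' d', k < k' → g k.1 + lab k d < g k'.1 + lab k' d' := fun k d k' d' h =>
    ((add_lt_add_right (hlab k d) _).trans_le (hle _ _ h)).trans_le le_self_add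
  refine ⟨fun k d => g k.1 + lab k d, fun k d => (hmono.le_apply).trans le_self_add,
    fun k => ⟨g k.1 + s k.1, hadd _ (hgc _ k.2) _ (hsc _ k.2), fun d =>
      add_lt_add_right (hlab k d) _⟩, ?_⟩
  intro k d k' d' h
  rcases lt_trichotomy k k' with hk | rfl | hk
  · exact absurd h (hlt k d k' d' hk).ne
  · rw [hlab' k (add_left_cancel h)]
  · exact absurd h (hlt k' d' k d hk).ne'

/-- A node is coded by the positions of itself and its ancestors. Going up from level `k` adds only
ordinals `≥ k`, invisible to `∼_k`. Conversely the positions of level `k` are bounded below `c`, so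
a late enough stage identifies the ancestor at level `k`, and a system near every level would define
a full branch. -/
theorem not_seqComplete_of_tree {κ : WithTop Cardinal.{u}} {c : Cardinal.{u}} (hc : c.IsRegular)
    (hcκ : SizeLT κ (Set.Iio c.ord)) (D : InverseChain.{u, u + 1} (Set.Iio c.ord))
    (hD : D.IsTidy) (hDc : ∀ k, #(D.level k) < c) (hbranch : ¬ ∃ x, D.IsFullBranch x) :
    ¬ SeqComplete κ c.ord := by
  have hi := isSuccPrelimit_ord hc
  have hne : ∀ k, Nonempty (D.level k) := by
    intro k
    obtain ⟨b, hb, ⟨x⟩⟩ := hD.root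
    exact ⟨(hD.surj b k (hb k) x).choose⟩
  obtain ⟨pos, hpos, hbd, hinj⟩ := exists_positions hc D.level hDc
  have hposc : ∀ k d, pos k d ≤ c.ord := fun k d => by
    obtain ⟨b, hb, h⟩ := hbd k
    exact ((h d).trans hb).le
  let code : ∀ k, D.level k → PointedSystem.{u} := fun k d =>
    collect fun e : {e : Set.Iio c.ord // e ≤ k} => ordSys (pos e.1 (D.map e.2 d))
  have hcode : ∀ k j (h : k ≤ j) d, Sim k.1 (code k (D.map h d)) (code j d) := by
    intro k j h d
    refine sim_collect_iff.2 fun l hl => ⟨?_, ?_⟩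
    · rintro ⟨e, he⟩
      refine ⟨⟨e, he.trans h⟩, ?_⟩
      dsimp only
      rw [D.map_map]
      exact .refl _ _
    · rintro ⟨e, he⟩
      rcases le_total e k with hek | hek
      · refine ⟨⟨e, hek⟩, ?_⟩
        dsimp only
        rw [D.map_map]
        exact .refl _ _
      · exact ⟨⟨k, le_rfl⟩, sim_ordSys_of_le (hl.le.trans (hpos _ _))
          (hl.le.trans (le_trans (show k.1 ≤ e.1 from hek) (hpos _ _)))⟩
  have hlevel : ∀ k, SizeLT κ (D.level k) := by
    intro k
    rw [sizeLT_Iio, card_ord] at hcκ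
    exact sizeLT_iff.2 ((WithTop.coe_lt_coe.2 (hDc k)).trans hcκ)
  refine not_seqComplete_of_family hi hc.ord_pos.ne' code hlevel ?_ ?_ ?_ ?_
  · intro k d
    refine isBranching_collect (hcκ.subtype _) fun e => isBranching_ordSys ?_
    exact hcκ.of_injective (Set.inclusion (Set.Iio_subset_Iio (hposc _ _)))
      (Set.inclusion_injective _)
  · exact fun k j h d => ⟨_, hcode k j h d⟩
  · intro k j h d
    obtain ⟨d', rfl⟩ := hD.surj k j h d
    exact ⟨d', hcode k j h d'⟩
  · intro z hz
    choose d hd using hz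
    choose b hb hbpos using hbd
    have hsim : ∀ k j, k ≤ j → Sim k.1 (code k (d k)) (code j (d j)) := fun k j h =>
      (hd k).trans ((hd j).mono (show k.1 ≤ j.1 from h)).symm
    -- From stage `J k > b k` on, all positions of level `k` are told apart, so the ancestor at
    -- level `k` no longer changes.
    let J : Set.Iio c.ord → Set.Iio c.ord := fun k => k ⊔ next hi ⟨b k, hb k⟩
    have hJ : ∀ k, k ≤ J k := fun k => le_sup_left
    have hstable : ∀ k j (h : J k ≤ j),
        D.map (hJ k) (d (J k)) = D.map ((hJ k).trans h) (d j) := by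
      intro k j h
      have hlt : b k < (J k).1 := lt_of_lt_of_le (Order.lt_succ (b k))
        (show next hi ⟨b k, hb k⟩ ≤ J k from le_sup_right)
      obtain ⟨⟨e, he⟩, hs⟩ := (sim_collect_iff.1 (hsim _ _ h) _ hlt).1 ⟨k, hJ k⟩
      have heq := hinj _ _ _ _ (eq_of_sim_ordSys hs (hbpos _ _))
      obtain rfl : k = e := congrArg Sigma.fst heq
      exact eq_of_heq (Sigma.mk.inj heq).2
    refine hbranch ⟨fun k => D.map (hJ k) (d (J k)), fun k l h => ?_⟩
    dsimp only
    rw [hstable k (J k ⊔ J l) le_sup_left, hstable l (J k ⊔ J l) le_sup_right, D.map_map]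

/-! ### Necessity of the condition and the classification -/

theorem SeqComplete.isGoodLimit {κ : WithTop Cardinal.{u}} (hκ : IsInfiniteRegular κ)
    {i : Ordinal.{u}} (hi : Order.IsSuccPrelimit i) (H : SeqComplete κ i) : IsGoodLimit κ i := by
  have hne : ¬ EqKappa κ i := by
    rintro ⟨c, rfl, rfl⟩
    exact not_seqComplete_ord (hκ c rfl) H
  refine ⟨hne, ?_⟩
  by_contra! h
  obtain ⟨h0, hω, hwc, hge⟩ := h
  have hiκ := sizeLT_of_not_geAddOmega hi hne hge
  by_cases hcof : ∃ β < i, i.cof ≤ 2 ^ β.card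
  · obtain ⟨β, hβ, hcof⟩ := hcof
    exact not_seqComplete_of_cof_le hκ hiκ hi h0 hβ hcof hω H
  · push Not at hcof
    have hlim : Order.IsSuccLimit i := ⟨by simpa using h0, hi⟩
    have hreg := isRegular_cof hlim
    have hord : i.cof.ord = i := by
      -- For every `β < i`, `|β| < 2^|β| < cof i`, so `i` is the initial ordinal of its cofinality.
      refine le_antisymm (Ordinal.ord_cof_le i) (le_of_forall_lt fun β hβ => ?_)
      exact lt_ord.2 ((cantor _).trans (hcof β hβ))
    generalize i.cof = c at *
    subst hord
    refine hwc ⟨c, rfl, hreg, ?_, ?_⟩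
    · intro A hA
      have := hcof _ (ord_lt_ord.2 hA)
      rwa [card_ord, ← mk_set] at this
    · intro D hD hDc
      by_contra hb
      exact not_seqComplete_of_tree hreg hiκ D hD hDc hb H

theorem seqComplete_iff {κ : WithTop Cardinal.{u}} (hκ : IsInfiniteRegular κ)
    {i : Ordinal.{u}} (hi : Order.IsSuccPrelimit i) : SeqComplete κ i ↔ IsGoodLimit κ i :=
  ⟨fun H => H.isGoodLimit hκ hi, fun h => h.seqComplete hκ hi⟩

end Ghost

theorem proposition7p20 (κ : WithTop Cardinal.{u}) (hκ : Ghost.IsInfiniteRegular κ) :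
    (∀ i : Ordinal.{u}, Order.IsSuccPrelimit i →
      ((∀ a ∈ Ghost.finalChain κ i, Ghost.IsCauchy κ i a → Ghost.IsCoalgebraic κ i a) ↔
        Ghost.IsGoodLimit κ i)) ∧
    (∀ i : Ordinal.{u},
      ((∀ x : Set.Iio i → Ghost.PointedSystem.{u},
          (∀ j, (x j).IsBranching κ) → Ghost.IsCauchySeq x →
          ∃ y : Ghost.PointedSystem.{u}, y.IsBranching κ ∧ Ghost.IsLimitOfSeq x y) ↔
        ((∃ k : Ordinal.{u}, i = Order.succ k) ∨ Ghost.IsGoodLimit κ i))) := by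
  refine ⟨fun i hi => (Ghost.forall_isCauchy_isCoalgebraic_iff hi).trans
    (Ghost.seqComplete_iff hκ hi), fun i => ?_⟩
  change Ghost.SeqComplete κ i ↔ _
  by_cases hi : Order.IsSuccPrelimit i
  · rw [Ghost.seqComplete_iff hκ hi]
    refine ⟨Or.inr, ?_⟩
    rintro (⟨k, rfl⟩ | h)
    · exact absurd hi (Order.not_isSuccPrelimit_succ k)
    · exact h
  · obtain ⟨k, -, rfl⟩ := Order.not_isSuccPrelimit_iff_succ_eq.1 hi
    exact iff_of_true (Ghost.seqComplete_succ k) (Or.inl ⟨k, rfl⟩)
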